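/- Let $n\ge 1$, $\hbar>0$, write $z=(x,p)\in\mathbb R^{2n}=\mathbb R^n_x\oplus\mathbb R^n_p$, let $R$ be a real symmetric $2n\times 2n$ matrix, $H(z)=\frac12 Rz\cdot z$, $J=\begin{pmatrix}0&I\\-I&0\end{pmatrix}$ and $S_t=e^{tJR}$. *Definitions.* A quantum blob is a set $\mathcal{QB}^{2n}(z_0,S)=z_0+S\,B(\sqrt\hbar)$, where $z_0\in\mathbb R^{2n}$, $S\in\mathrm{Sp}(2n,\mathbb R)$, and $B(\sqrt\hbar)$ is the closed ball of radius $\sqrt\hbar$ centred at $0$. A squeezed coherent state is a function in $L^2(\mathbb R^n)$ of the form $$e^{\frac i\hbar\gamma}\,e^{\frac i\hbar(p_0\cdot x-\frac12p_0\cdot x_0)}\,\Phi_{X,Y}(x-x_0),\qquad \Phi_{X,Y}(x)=(\pi\hbar)^{-n/4}(\det X)^{1/4}e^{-\frac1{2\hbar}(X+iY)x\cdot x},$$ with $\gamma\in\mathbb R$, $(x_0,p_0)\in\mathbb R^{2n}$, and $X,Y$ real symmetric $n\times n$ matrices, $X$ positive definite. The Wigner transform of $\Psi$ is $$W\Psi(x,p)=(2\pi\hbar)^{-n}\int_{\mathbb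 R^n}e^{-\frac i\hbar p\cdot y}\,\Psi(x+\tfrac12y)\,\overline{\Psi(x-\tfrac12y)}\,dy .$$ A set $Q\subset\mathbb R^{2n}$ corresponds to $\Psi\in L^2(\mathbb R^n)$ if there are a real symmetric positive definite $2n\times2n$ matrix $G$ and $\bar z\in\mathbb R^{2n}$ such that $W\Psi(z)=(\pi\hbar)^{-n}e^{-\frac1\hbar G(z-\bar z)\cdot(z-\bar z)}$ for all $z$, and $Q=\{z: G(z-\bar z)\cdot(z-\bar z)\le\hbar\}$. The Weyl quantization of $H$ is the operator $\widehat H=\frac12\sum_{\alpha,\beta}R_{\alpha\beta}\,\frac12(\hat z_\alpha\hat z_\beta+\hat z_\beta\hat z_\alpha)$ on Schwartz functions, where $\hat x_j$ is multiplication by $x_j$ and $\hat p_j=-i\hbar\,\partial/\partial x_j$. A solution of Schrödinger's equation $i\hbar\,\partial_t\Psi=\widehat H\Psi$ is a continuous map $\Psi:\mathbb R\to L^2(\mathbb R^n)$ such that $i\hbar\frac{d}{dt}\langle\varphi,\Psi(t)\rangle=\langle\widehat H\varphi,\Psi(t)\rangle$ for all Schwartz functions $\varphi$ and all $t\in\mathbb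 R$. *Proposition.* 1. Each $S_t$ is symplectic, and $t\mapsto z_t$ solves Hamilton's equations $\dot x=\nabla_pH$, $\dot p=-\nabla_xH$ on $\mathbb R$ if and only if $z_t=S_tz_0$ for all $t$. 2. To every squeezed coherent state there corresponds exactly one set, which is a quantum blob; and every quantum blob corresponds to some squeezed coherent state. 3. Let $t\mapsto z_t$ be a solution of Hamilton's equations, let $S_0\in\mathrm{Sp}(2n,\mathbb R)$, and let $\Psi_0$ be a squeezed coherent state whose quantum blob is $\mathcal{QB}^{2n}(z_0,S_0)$. Then Schrödinger's equation has exactly one solution $\Psi$ with $\Psi(0)=\Psi_0$. For every $t\in\mathbb R$, $\Psi(t)$ is a squeezed coherent state, and the unique set that corresponds to it is the quantum blob $$S_t\big[\mathcal{QB}^{2n}(z_0,S_0)\big]=\mathcal{QB}^{2n}(z_t,\,S_tS_0).$$ So the quantum motion of coherent states induces the classical motion of the corresponding quantum blobs. -/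

import Mathlib

open MeasureTheory
open scoped Matrix SchwartzMap

noncomputable section

namespace QuantumBlobs

/-- Configuration space `ℝⁿ` with its Euclidean structure and Lebesgue measure. -/
abbrev ConfigSpace (n : ℕ) : Type := EuclideanSpace ℝ (Fin n)

/-- Phase space `ℝ²ⁿ = ℝⁿ ⊕ ℝⁿ`; the coordinate `Sum.inl j` is `x_j`, and `Sum.inr j` is `p_j`. -/
abbrev PhaseSpace (n : ℕ) : Type := EuclideanSpace ℝ (Fin n ⊕ Fin n)

variable {n : ℕ}

/-- The position component `x` of `z = (x, p)`. -/
def position (z : PhaseSpace n) : ConfigSpace n := WithLp.toLp 2 fun j => z (Sum.inl j)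

/-- The momentum component `p` of `z = (x, p)`. -/
def momentum (z : PhaseSpace n) : ConfigSpace n := WithLp.toLp 2 fun j => z (Sum.inr j)

/-- The quadratic form `A v · v` of a real matrix. -/
def quadForm {ι : Type*} [Fintype ι] (A : Matrix ι ι ℝ) (v : EuclideanSpace ℝ ι) : ℝ :=
  (A *ᵥ v.ofLp) ⬝ᵥ v.ofLp

/-! ### Classical mechanics -/

/-- The quadratic Hamiltonian `H(z) = ½ R z · z`. -/
def quadraticHamiltonian (R : Matrix (Fin n ⊕ Fin n) (Fin n ⊕ Fin n) ℝ) (z : PhaseSpace n) : ℝ :=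
  (1 / 2) * quadForm R z

/-- `z` solves Hamilton's equations `ẋ = ∇_p H`, `ṗ = -∇_x H` on the whole time axis. -/
def IsHamiltonTrajectory (H : PhaseSpace n → ℝ) (z : ℝ → PhaseSpace n) : Prop :=
  ∀ (t : ℝ) (j : Fin n),
    HasDerivAt (fun s => z s (Sum.inl j))
      (fderiv ℝ H (z t) (EuclideanSpace.single (Sum.inr j) 1)) t ∧
    HasDerivAt (fun s => z s (Sum.inr j))
      (-(fderiv ℝ H (z t) (EuclideanSpace.single (Sum.inl j) 1))) t

/-- The matrix `(0 I; -I 0)`, in which Hamilton's equations for `H(z) = ½ R z · z` read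
`ż = J₀ R z`. (Mathlib's `Matrix.J` is its negative; both define the same symplectic group.) -/
def standardJ (n : ℕ) : Matrix (Fin n ⊕ Fin n) (Fin n ⊕ Fin n) ℝ :=
  Matrix.fromBlocks 0 1 (-1) 0

/-- The matrix `S_t = exp (t J₀ R)` of the flow of `H(z) = ½ R z · z`. -/
def classicalFlow (R : Matrix (Fin n ⊕ Fin n) (Fin n ⊕ Fin n) ℝ) (t : ℝ) :
    Matrix (Fin n ⊕ Fin n) (Fin n ⊕ Fin n) ℝ :=
  NormedSpace.exp (t • (standardJ n * R))

/-- `T(z₀) S B(√ħ)`, the image of the closed ball of radius `√ħ` centred at `0`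
under the matrix `S`, translated by `z₀`. It is called a quantum blob when `S` is symplectic. -/
def quantumBlob (ħ : ℝ) (z₀ : PhaseSpace n)
    (S : Matrix (Fin n ⊕ Fin n) (Fin n ⊕ Fin n) ℝ) : Set (PhaseSpace n) :=
  (fun z => z + z₀) '' (Matrix.toEuclideanLin S '' Metric.closedBall 0 (Real.sqrt ħ))

/-! ### Squeezed coherent states and their Wigner transforms -/

/-- The centred Gaussian
`Φ_{X,Y}(x) = (πħ)^{-n/4} (det X)^{1/4} exp (-(1/2ħ) (X + iY) x · x)`. -/
def squeezedGaussian (ħ : ℝ) (X Y : Matrix (Fin n) (Fin n) ℝ) (x : ConfigSpace n) : ℂ :=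
  (((Real.pi * ħ) ^ (-(n : ℝ) / 4) * X.det ^ (1 / 4 : ℝ) : ℝ) : ℂ) *
    Complex.exp (-(1 / (2 * (ħ : ℂ))) * ((quadForm X x : ℂ) + Complex.I * (quadForm Y x : ℂ)))

/-- The Heisenberg--Weyl operator
`T̂(z₀) ψ (x) = exp ((i/ħ) (p₀ · x - ½ p₀ · x₀)) ψ (x - x₀)`. -/
def heisenbergWeyl (ħ : ℝ) (z₀ : PhaseSpace n) (ψ : ConfigSpace n → ℂ) (x : ConfigSpace n) : ℂ :=
  Complex.exp (Complex.I / (ħ : ℂ) *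
      ((inner ℝ (momentum z₀) x - (1 / 2) * inner ℝ (momentum z₀) (position z₀) : ℝ) : ℂ)) *
    ψ (x - position z₀)

/-- The Hilbert space `L²(ℝⁿ)` of wavefunctions. -/
abbrev StateSpace (n : ℕ) : Type := Lp ℂ 2 (volume : Measure (ConfigSpace n))

/-- `ψ = e^{iγ/ħ} T̂(z₀) Φ_{X,Y}` for some real phase `γ`, some `z₀`, some real symmetric `X`, `Y`,
with `X` positive definite. (For real matrices `Matrix.PosDef` includes symmetry.) -/
def IsSqueezedCoherentState (ħ : ℝ) (ψ : StateSpace n) : Prop :=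
  ∃ (X Y : Matrix (Fin n) (Fin n) ℝ) (z₀ : PhaseSpace n) (γ : ℝ), X.PosDef ∧ Y.IsSymm ∧
    ψ =ᵐ[volume] fun x =>
      Complex.exp (Complex.I / (ħ : ℂ) * (γ : ℂ)) * heisenbergWeyl ħ z₀ (squeezedGaussian ħ X Y) x

/-- The Wigner transform
`Wψ(x,p) = (2πħ)^{-n} ∫ e^{-(i/ħ) p · y} ψ(x + y/2) ψ(x - y/2)^* dy`. -/
def wigner (ħ : ℝ) (ψ : ConfigSpace n → ℂ) (z : PhaseSpace n) : ℂ :=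
  (1 / (2 * (Real.pi : ℂ) * (ħ : ℂ))) ^ n *
    ∫ y : ConfigSpace n,
      Complex.exp (-(Complex.I / (ħ : ℂ)) * ((inner ℝ (momentum z) y : ℝ) : ℂ)) *
        ψ (position z + (1 / 2 : ℝ) • y) *
        (starRingEnd ℂ) (ψ (position z - (1 / 2 : ℝ) • y))

/-- The correspondence between states with Gaussian Wigner transform and ellipsoids:
`Wψ(z) = (πħ)^{-n} exp (-(1/ħ) G(z - z₀) · (z - z₀))` for all `z`, and
`Q = {z | G(z - z₀) · (z - z₀) ≤ ħ}`. -/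
def CorrespondsTo (ħ : ℝ) (ψ : StateSpace n) (Q : Set (PhaseSpace n)) : Prop :=
  ∃ (G : Matrix (Fin n ⊕ Fin n) (Fin n ⊕ Fin n) ℝ) (z₀ : PhaseSpace n), G.PosDef ∧
    (∀ z : PhaseSpace n, wigner ħ ψ z =
      (((1 / (Real.pi * ħ)) ^ n * Real.exp (-(1 / ħ) * quadForm G (z - z₀)) : ℝ) : ℂ)) ∧
    Q = {z | quadForm G (z - z₀) ≤ ħ}

/-! ### Schrödinger's equation -/

/-- The quantized coordinates on Schwartz functions: `x̂_j` is multiplication by `x_j`, and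
`p̂_j = -iħ ∂/∂x_j`. -/
def quantizedCoord (ħ : ℝ) : Fin n ⊕ Fin n → (𝓢(ConfigSpace n, ℂ) →L[ℂ] 𝓢(ConfigSpace n, ℂ))
  | Sum.inl j => SchwartzMap.smulLeftCLM ℂ (fun x : ConfigSpace n => ((x j : ℝ) : ℂ))
  | Sum.inr j => (-(Complex.I * (ħ : ℂ))) •
      LineDeriv.lineDerivOpCLM ℂ 𝓢(ConfigSpace n, ℂ) (EuclideanSpace.single j (1 : ℝ))

theorem quantizedCoord_inl_apply (ħ : ℝ) (j : Fin n) (φ : 𝓢(ConfigSpace n, ℂ))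
    (x : ConfigSpace n) : quantizedCoord ħ (Sum.inl j) φ x = (x j : ℂ) * φ x := by
  have h : (fun x : ConfigSpace n => ((x j : ℝ) : ℂ)).HasTemperateGrowth :=
    (Complex.ofRealCLM.comp (EuclideanSpace.proj (𝕜 := ℝ) j)).hasTemperateGrowth
  simp [quantizedCoord, SchwartzMap.smulLeftCLM_apply_apply h]

theorem quantizedCoord_inr_apply (ħ : ℝ) (j : Fin n) (φ : 𝓢(ConfigSpace n, ℂ))
    (x : ConfigSpace n) : quantizedCoord ħ (Sum.inr j) φ x =
      -(Complex.I * (ħ : ℂ)) * lineDeriv ℝ φ x (EuclideanSpace.single j (1 : ℝ)) := by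
  simp [quantizedCoord, SchwartzMap.lineDerivOp_apply]

/-- The Weyl quantization of `H(z) = ½ R z · z = ½ ∑ R_{αβ} z_α z_β` on Schwartz functions: every
product `z_α z_β` is replaced by the symmetrized product `½ (ẑ_α ẑ_β + ẑ_β ẑ_α)`. -/
def weylHamiltonian (ħ : ℝ) (R : Matrix (Fin n ⊕ Fin n) (Fin n ⊕ Fin n) ℝ) :
    𝓢(ConfigSpace n, ℂ) →L[ℂ] 𝓢(ConfigSpace n, ℂ) :=
  (1 / 2 : ℂ) • ∑ α, ∑ β, (R α β : ℂ) • ((1 / 2 : ℂ) •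
    ((quantizedCoord ħ α).comp (quantizedCoord ħ β) +
      (quantizedCoord ħ β).comp (quantizedCoord ħ α)))

/-- `Ψ` is a (weak) solution in `C(ℝ, L²(ℝⁿ))` of Schrödinger's equation `iħ ∂Ψ/∂t = Ĥ Ψ`, where
`Ĥ` is the Weyl quantization of `½ R z · z`: the curve `Ψ` is continuous, and
`iħ (d/dt) ⟨φ, Ψ(t)⟩ = ⟨Ĥ φ, Ψ(t)⟩` for every `t` and every Schwartz function `φ`. -/
def IsSchrodingerSolution (ħ : ℝ) (R : Matrix (Fin n ⊕ Fin n) (Fin n ⊕ Fin n) ℝ)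
    (Ψ : ℝ → StateSpace n) : Prop :=
  Continuous Ψ ∧ ∀ (φ : 𝓢(ConfigSpace n, ℂ)) (t : ℝ),
    HasDerivAt (fun s => inner ℂ (φ.toLp 2 volume) (Ψ s))
      ((Complex.I * (ħ : ℂ))⁻¹ * inner ℂ ((weylHamiltonian ħ R φ).toLp 2 volume) (Ψ t)) t

end QuantumBlobs

end

/-! The classical and the quantum side both reduce to one matrix. The blob `z₀ + S B(√ħ)` is the
ellipsoid `G(z - z₀)·(z - z₀) ≤ ħ` with `G = (S Sᵀ)⁻¹`, which is positive definite and symplectic.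
For a squeezed state with parameters `X`, `Y` and centre `z₀`, completing the square in the Gaussian
integral (`wigner_coherentState`) gives a Gaussian Wigner transform, centred at `z₀`, with matrix
`blobMatrix X Y`. The matrices `blobMatrix X Y` are exactly the positive definite symplectic ones
(`exists_symplectic_blobMatrix`, `isSymm_blobY_and_blobMatrix_eq`), so states and blobs match. The
set attached to a state is unique because its Wigner transform determines the quadratic function in
the exponent.

For the dynamics, the classical flow carries the ellipsoid of `G` to that of `G_t = S_{-t}ᵀ G
S_{-t}`, which is again positive definite and symplectic. Let `X_t`, `Y_t` be its parameters. The
linear equation for `G_t` becomes a matrix Riccati equation for `X_t`, `Y_t`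
(`hasDerivAt_blobX_blobY`), whose solution is thus global. On a Gaussian, `x̂` and `p̂` multiply by
functions affine in `x`, so `Ĥ` multiplies it by a quadratic polynomial. Matching this with the time
derivative of the exponent gives the Riccati equation in degree two, Hamilton's equations for the
centre, and a scalar equation for the logarithm `c` of the amplitude, solved by integration. Hence
an explicit Gaussian curve solves Schrödinger's equation strongly in `L²`
(`hasDerivAt_gaussianWave`, `isStrongSolution_gaussianFlow`). Integrating for `c` involves no choice
of a square root of a determinant.

A strong solution has constant inner product with every weak solution (`IsStrongSolution.inner_eq`).
Paired with itself, the Gaussian curve keeps norm one, so it remains a squeezed coherent state.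
Paired with the difference of two weak solutions that agree at time `0`, the Gaussian solutions show
that this difference is orthogonal, at any time `T`, to all Gaussians `e^{ip·x/ħ} φ`; it vanishes by
injectivity of the Fourier transform (`eq_zero_of_inner_coherentState`). Neither self-adjointness of
`Ĥ` nor metaplectic operators are needed. -/

noncomputable section

namespace QuantumBlobs

variable {n : ℕ}

/-! ### Quadratic forms of real matrices -/

section QuadraticForms

theorem isSymm_of_posDef {ι : Type*} {A : Matrix ι ι ℝ} (hA : A.PosDef) : A.IsSymm := by
  simpa [Matrix.IsHermitian, Matrix.IsSymm] using hA.isHermitian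

theorem quadForm_nonneg {ι : Type*} [Fintype ι] {A : Matrix ι ι ℝ} (hA : A.PosDef)
    (v : EuclideanSpace ℝ ι) :
    0 ≤ quadForm A v := by
  have := hA.posSemidef.dotProduct_mulVec_nonneg v.ofLp
  rwa [star_trivial, dotProduct_comm] at this

variable {ι : Type*} [Fintype ι] [DecidableEq ι]

theorem quadForm_eq_inner (A : Matrix ι ι ℝ) (v : EuclideanSpace ℝ ι) :
    quadForm A v = inner ℝ (Matrix.toEuclideanLin A v) v := by
  simp [quadForm, EuclideanSpace.inner_eq_star_dotProduct, dotProduct_comm]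

theorem inner_toEuclideanLin_left (A : Matrix ι ι ℝ) (u v : EuclideanSpace ℝ ι) :
    inner ℝ (Matrix.toEuclideanLin A u) v = inner ℝ u (Matrix.toEuclideanLin Aᵀ v) := by
  simp only [EuclideanSpace.inner_eq_star_dotProduct, star_trivial, Matrix.ofLp_toLpLin,
    Matrix.toLin'_apply]
  rw [Matrix.mulVec_transpose, ← Matrix.dotProduct_mulVec]

theorem toEuclideanLin_mul_apply (A B : Matrix ι ι ℝ) (v : EuclideanSpace ℝ ι) :
    Matrix.toEuclideanLin (A * B) v = Matrix.toEuclideanLin A (Matrix.toEuclideanLin B v) := by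
  ext i
  simp [Matrix.mulVec_mulVec]

theorem toEuclideanLin_one_apply (v : EuclideanSpace ℝ ι) :
    Matrix.toEuclideanLin (1 : Matrix ι ι ℝ) v = v := by
  ext i
  simp

theorem quadForm_congr (A S : Matrix ι ι ℝ) (v : EuclideanSpace ℝ ι) :
    quadForm (Sᵀ * A * S) v = quadForm A (Matrix.toEuclideanLin S v) := by
  rw [quadForm_eq_inner, quadForm_eq_inner, toEuclideanLin_mul_apply, toEuclideanLin_mul_apply,
    inner_toEuclideanLin_left, Matrix.transpose_transpose]

theorem quadForm_one (v : EuclideanSpace ℝ ι) : quadForm (1 : Matrix ι ι ℝ) v = ‖v‖ ^ 2 := by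
  rw [quadForm_eq_inner, toEuclideanLin_one_apply, real_inner_self_eq_norm_sq]

theorem quadForm_transpose_mul_self (S : Matrix ι ι ℝ) (v : EuclideanSpace ℝ ι) :
    quadForm (Sᵀ * S) v = ‖Matrix.toEuclideanLin S v‖ ^ 2 := by
  rw [← quadForm_one, ← quadForm_congr, mul_one]

theorem quadForm_add (A : Matrix ι ι ℝ) (hA : A.IsSymm) (u v : EuclideanSpace ℝ ι) :
    quadForm A (u + v) =
      quadForm A u + 2 * inner ℝ (Matrix.toEuclideanLin A u) v + quadForm A v := by
  have h : inner ℝ (Matrix.toEuclideanLin A v) u = inner ℝ (Matrix.toEuclideanLin A u) v := by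
    rw [inner_toEuclideanLin_left, hA, real_inner_comm]
  simp only [quadForm_eq_inner, map_add, inner_add_left, inner_add_right, h]
  ring

theorem quadForm_smul (A : Matrix ι ι ℝ) (c : ℝ) (v : EuclideanSpace ℝ ι) :
    quadForm A (c • v) = c ^ 2 * quadForm A v := by
  simp only [quadForm_eq_inner, map_smul, real_inner_smul_left, real_inner_smul_right]
  ring

theorem quadForm_neg (A : Matrix ι ι ℝ) (v : EuclideanSpace ℝ ι) :
    quadForm A (-v) = quadForm A v := by
  simp [quadForm_eq_inner]

theorem isUnit_det_of_posDef {A : Matrix ι ι ℝ} (hA : A.PosDef) : IsUnit A.det :=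
  (Matrix.isUnit_iff_isUnit_det A).1 hA.isUnit

open MatrixOrder in
theorem exists_transpose_mul_self {A : Matrix ι ι ℝ} (hA : A.PosDef) :
    ∃ P : Matrix ι ι ℝ, IsUnit P.det ∧ A = Pᵀ * P := by
  obtain ⟨P, hP⟩ := CStarAlgebra.nonneg_iff_eq_star_mul_self.mp hA.posSemidef.nonneg
  have hP' : A = Pᵀ * P := by simpa [Matrix.star_eq_conjTranspose] using hP
  refine ⟨P, ?_, hP'⟩
  have := isUnit_det_of_posDef hA
  rw [hP', Matrix.det_mul] at this
  exact isUnit_of_mul_isUnit_right this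

theorem posDef_transpose_mul_self {P : Matrix ι ι ℝ} (hP : IsUnit P.det) : (Pᵀ * P).PosDef := by
  have := Matrix.PosDef.conjTranspose_mul_self P
    (Matrix.mulVec_injective_iff_isUnit.2 ((Matrix.isUnit_iff_isUnit_det P).2 hP))
  simpa using this

end QuadraticForms

/-! ### The linear Hamiltonian flow -/

section Classical

theorem quadraticHamiltonian_fderiv (R : Matrix (Fin n ⊕ Fin n) (Fin n ⊕ Fin n) ℝ)
    (hR : R.IsSymm) (z : PhaseSpace n) (α : Fin n ⊕ Fin n) :
    fderiv ℝ (quadraticHamiltonian R) z (EuclideanSpace.single α 1) =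
      (R *ᵥ z.ofLp) α := by
  set T : PhaseSpace n →L[ℝ] PhaseSpace n := (Matrix.toEuclideanLin R).toContinuousLinearMap
  have h : quadraticHamiltonian R = fun z => (1 / 2 : ℝ) * inner ℝ (T z) z := by
    funext w
    rw [quadraticHamiltonian, quadForm_eq_inner]
    rfl
  have hT : DifferentiableAt ℝ (fun z => inner ℝ (T z) z) z :=
    (T.differentiableAt).inner ℝ differentiableAt_id
  rw [h, fderiv_const_mul hT, smul_apply,
    fderiv_inner_apply ℝ T.differentiableAt differentiableAt_fun_id]
  have h1 : ∀ v, inner ℝ (T v) z = inner ℝ (T z) v := by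
    intro v
    change inner ℝ (Matrix.toEuclideanLin R v) z = inner ℝ (Matrix.toEuclideanLin R z) v
    rw [inner_toEuclideanLin_left, hR, real_inner_comm]
  have h2 : inner ℝ (T z) (EuclideanSpace.single α 1) = (R *ᵥ z.ofLp) α := by
    simp [T, EuclideanSpace.inner_single_right]
  simp only [fderiv_fun_id, ContinuousLinearMap.fderiv, ContinuousLinearMap.id_apply, h1, h2,
    smul_eq_mul]
  ring

theorem standardJ_eq (n : ℕ) : standardJ n = -Matrix.J (Fin n) ℝ := by
  simp [standardJ, Matrix.J, Matrix.fromBlocks_neg]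

theorem isHamiltonTrajectory_iff (R : Matrix (Fin n ⊕ Fin n) (Fin n ⊕ Fin n) ℝ)
    (hR : R.IsSymm) (z : ℝ → PhaseSpace n) :
    IsHamiltonTrajectory (quadraticHamiltonian R) z ↔
      ∀ t, HasDerivAt (fun s => (z s).ofLp) ((standardJ n * R) *ᵥ (z t).ofLp) t := by
  refine forall_congr' fun t => ?_
  have hv : ∀ v : Fin n ⊕ Fin n → ℝ,
      standardJ n *ᵥ v = Sum.elim (fun j => v (Sum.inr j)) (fun j => -v (Sum.inl j)) := by
    intro v
    rw [standardJ, Matrix.fromBlocks_mulVec]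
    simp only [Matrix.zero_mulVec, Matrix.one_mulVec, zero_add, add_zero, Matrix.neg_mulVec]
    rfl
  rw [hasDerivAt_pi, ← Matrix.mulVec_mulVec, hv]
  simp only [quadraticHamiltonian_fderiv R hR, Sum.forall, Sum.elim_inl, Sum.elim_inr]
  exact forall_and

theorem classicalFlow_zero (R : Matrix (Fin n ⊕ Fin n) (Fin n ⊕ Fin n) ℝ) :
    classicalFlow R 0 = 1 := by
  simp [classicalFlow]

section
-- The norm serves only to apply the calculus of normed algebras to exponentials, products and
-- inverses; derivatives of matrix curves are afterwards read entrywise.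
attribute [local instance] Matrix.linftyOpNormedRing Matrix.linftyOpNormedAlgebra

theorem classicalFlow_add (R : Matrix (Fin n ⊕ Fin n) (Fin n ⊕ Fin n) ℝ) (s t : ℝ) :
    classicalFlow R (s + t) = classicalFlow R s * classicalFlow R t := by
  rw [classicalFlow, add_smul]
  exact Matrix.exp_add_of_commute _ _
    (((Commute.refl (standardJ n * R)).smul_left s).smul_right t)

theorem hasDerivAt_classicalFlow (R : Matrix (Fin n ⊕ Fin n) (Fin n ⊕ Fin n) ℝ) (t : ℝ) :
    HasDerivAt (classicalFlow R) (standardJ n * R * classicalFlow R t) t :=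
  hasDerivAt_exp_smul_const' (standardJ n * R) t

theorem hasDerivAt_classicalFlow' (R : Matrix (Fin n ⊕ Fin n) (Fin n ⊕ Fin n) ℝ) (t : ℝ) :
    HasDerivAt (classicalFlow R) (classicalFlow R t * (standardJ n * R)) t :=
  hasDerivAt_exp_smul_const (standardJ n * R) t

theorem hasDerivAt_matrix_mul {ι : Type*} [Fintype ι] [DecidableEq ι] {A B : ℝ → Matrix ι ι ℝ}
    {A' B' : Matrix ι ι ℝ} {t : ℝ} (hA : HasDerivAt A A' t) (hB : HasDerivAt B B' t) :
    HasDerivAt (fun s => A s * B s) (A' * B t + A t * B') t :=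
  HasDerivAt.mul hA hB

theorem hasDerivAt_matrix_inv {ι : Type*} [Fintype ι] [DecidableEq ι] {A : ℝ → Matrix ι ι ℝ}
    {A' : Matrix ι ι ℝ} {t : ℝ} (hA : HasDerivAt A A' t) (h : IsUnit (A t)) :
    HasDerivAt (fun s => (A s)⁻¹) (-((A t)⁻¹ * A' * (A t)⁻¹)) t := by
  obtain ⟨u, hu⟩ := h
  have h1 := hasFDerivAt_ringInverse (𝕜 := ℝ) u
  rw [hu] at h1
  have h2 := h1.comp_hasDerivAt t hA
  have h3 : (Ring.inverse ∘ A) = fun s => (A s)⁻¹ := by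
    funext s
    exact (Matrix.nonsing_inv_eq_ringInverse (A s)).symm
  rw [h3] at h2
  have h4 : (↑u⁻¹ : Matrix ι ι ℝ) = (A t)⁻¹ := by rw [← hu, Matrix.coe_units_inv]
  have h5 : (-((ContinuousLinearMap.mulLeftRight ℝ (Matrix ι ι ℝ)) ↑u⁻¹) ↑u⁻¹) A' =
      -((A t)⁻¹ * A' * (A t)⁻¹) := by simp [h4]
  rw [h5] at h2
  exact h2

theorem hasDerivAt_matrix_iff {ι κ : Type*} [Fintype ι] [Fintype κ] {A : ℝ → Matrix ι κ ℝ}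
    {A' : Matrix ι κ ℝ} {t : ℝ} :
    HasDerivAt A A' t ↔ ∀ i j, HasDerivAt (fun s => A s i j) (A' i j) t :=
  (hasDerivAt_pi (φ := A)).trans (forall_congr' fun _ => hasDerivAt_pi)

end

theorem hasDerivAt_matrix_mulVec {ι : Type*} [Fintype ι] {A : ℝ → Matrix ι ι ℝ}
    {A' : Matrix ι ι ℝ} {v : ℝ → ι → ℝ} {v' : ι → ℝ} {t : ℝ} (hA : HasDerivAt A A' t)
    (hv : HasDerivAt v v' t) :
    HasDerivAt (fun s => A s *ᵥ v s) (A' *ᵥ v t + A t *ᵥ v') t := by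
  rw [hasDerivAt_pi]
  intro i
  have h := HasDerivAt.fun_sum (u := Finset.univ) fun j _ =>
    (hasDerivAt_matrix_iff.1 hA i j).mul (hasDerivAt_pi.1 hv j)
  simpa [Matrix.mulVec, dotProduct, Finset.sum_add_distrib] using h

theorem classicalFlow_neg_mul (R : Matrix (Fin n ⊕ Fin n) (Fin n ⊕ Fin n) ℝ) (t : ℝ) :
    classicalFlow R (-t) * classicalFlow R t = 1 := by
  rw [← classicalFlow_add, neg_add_cancel, classicalFlow_zero]

theorem hasDerivAt_classicalFlow_neg (R : Matrix (Fin n ⊕ Fin n) (Fin n ⊕ Fin n) ℝ) (t : ℝ) :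
    HasDerivAt (fun s => classicalFlow R (-s))
      (-(classicalFlow R (-t) * (standardJ n * R))) t := by
  rw [hasDerivAt_matrix_iff]
  intro i j
  have h := (hasDerivAt_matrix_iff.1 (hasDerivAt_classicalFlow' R (-t)) i j).comp t
    (hasDerivAt_neg t)
  simpa [Function.comp_def] using h

theorem hasDerivAt_matrix_const {ι κ : Type*} [Fintype ι] [Fintype κ] (A : Matrix ι κ ℝ) (t : ℝ) :
    HasDerivAt (fun _ : ℝ => A) 0 t :=
  hasDerivAt_matrix_iff.2 fun i j => hasDerivAt_const t (A i j)

theorem isHamiltonTrajectory_iff_flow (R : Matrix (Fin n ⊕ Fin n) (Fin n ⊕ Fin n) ℝ)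
    (hR : R.IsSymm) (z : ℝ → PhaseSpace n) :
    IsHamiltonTrajectory (quadraticHamiltonian R) z ↔
      ∀ t, z t = Matrix.toEuclideanLin (classicalFlow R t) (z 0) := by
  rw [isHamiltonTrajectory_iff R hR]
  have key : (∀ t, z t = Matrix.toEuclideanLin (classicalFlow R t) (z 0)) ↔
      ∀ t, (z t).ofLp = classicalFlow R t *ᵥ (z 0).ofLp := by
    refine forall_congr' fun t => ⟨fun h => by rw [h]; simp, fun h => ?_⟩
    apply WithLp.ofLp_injective
    rw [h]; simp
  rw [key]
  constructor
  · intro h t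
    -- Uniqueness for the linear system: a solution pulled back by the flow is constant.
    have hd : ∀ s, HasDerivAt (fun s => classicalFlow R (-s) *ᵥ (z s).ofLp) 0 s := by
      intro s
      have := hasDerivAt_matrix_mulVec (hasDerivAt_classicalFlow_neg R s) (h s)
      convert! this using 1
      rw [Matrix.mulVec_mulVec, ← Matrix.add_mulVec, neg_add_cancel, Matrix.zero_mulVec]
    have hc := is_const_of_deriv_eq_zero (fun s => (hd s).differentiableAt)
      (fun s => (hd s).deriv) t 0
    simp only [neg_zero, classicalFlow_zero, Matrix.one_mulVec] at hc
    rw [← hc, Matrix.mulVec_mulVec, ← classicalFlow_add, add_neg_cancel, classicalFlow_zero,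
      Matrix.one_mulVec]
  · intro h t
    have hz : (fun s => (z s).ofLp) = fun s => classicalFlow R s *ᵥ (z 0).ofLp := funext h
    rw [hz, h t]
    have := hasDerivAt_matrix_mulVec (hasDerivAt_classicalFlow R t)
      (hasDerivAt_const t (z 0).ofLp)
    simpa [Matrix.mulVec_mulVec] using this

theorem hasDerivAt_matrix_transpose {ι : Type*} [Fintype ι] {A : ℝ → Matrix ι ι ℝ}
    {A' : Matrix ι ι ℝ} {t : ℝ} (hA : HasDerivAt A A' t) :
    HasDerivAt (fun s => (A s)ᵀ) A'ᵀ t := by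
  rw [hasDerivAt_matrix_iff] at hA ⊢
  exact fun i j => hA j i

theorem classicalFlow_mem_symplecticGroup (R : Matrix (Fin n ⊕ Fin n) (Fin n ⊕ Fin n) ℝ)
    (hR : R.IsSymm) (t : ℝ) : classicalFlow R t ∈ Matrix.symplecticGroup (Fin n) ℝ := by
  rw [SymplecticGroup.mem_iff]
  set J := Matrix.J (Fin n) ℝ
  have hJ : J * J = -1 := Matrix.J_squared (Fin n) ℝ
  have hJt : Jᵀ = -J := Matrix.J_transpose (Fin n) ℝ
  -- `S_s J S_sᵀ` is constant because its derivative is `S_s (KJ + J Kᵀ) S_sᵀ` with `K = -J R`, and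
  -- `KJ + J Kᵀ = 0` by symmetry of `R` and `J² = -1`. This needs the form of the derivative in
  -- which the generator stands on the right of `S_s`.
  have hd : ∀ s, HasDerivAt (fun s => classicalFlow R s * J * (classicalFlow R s)ᵀ) 0 s := by
    intro s
    have h1 := hasDerivAt_matrix_mul (hasDerivAt_classicalFlow' R s) (hasDerivAt_matrix_const J s)
    have h2 := hasDerivAt_matrix_mul h1 (hasDerivAt_matrix_transpose (hasDerivAt_classicalFlow' R s))
    convert! h2 using 1
    simp only [standardJ_eq, Matrix.transpose_mul, Matrix.transpose_neg, hR.eq]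
    simp [mul_assoc, J]
  have hd' : ∀ i j s, HasDerivAt (fun s => (classicalFlow R s * J * (classicalFlow R s)ᵀ) i j) 0 s :=
    fun i j s => hasDerivAt_matrix_iff.1 (hd s) i j
  ext i j
  have hc := is_const_of_deriv_eq_zero (fun s => (hd' i j s).differentiableAt)
    (fun s => (hd' i j s).deriv) t 0
  rw [hc, classicalFlow_zero]
  simp

end Classical

/-! ### Blobs as ellipsoids; positive definite symplectic matrices -/

/-- The matrix of the Gaussian Wigner transform of the state with covariance data `X + iY`. -/
def blobMatrix (X Y : Matrix (Fin n) (Fin n) ℝ) : Matrix (Fin n ⊕ Fin n) (Fin n ⊕ Fin n) ℝ :=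
  Matrix.fromBlocks (X + Y * X⁻¹ * Y) (Y * X⁻¹) (X⁻¹ * Y) X⁻¹

theorem quantumBlob_eq {ħ : ℝ} (z₀ : PhaseSpace n)
    {S : Matrix (Fin n ⊕ Fin n) (Fin n ⊕ Fin n) ℝ} (hS : IsUnit S.det) :
    quantumBlob ħ z₀ S = {z | ‖Matrix.toEuclideanLin S⁻¹ (z - z₀)‖ ≤ Real.sqrt ħ} := by
  ext z
  simp only [quantumBlob, Set.mem_image, Metric.mem_closedBall, dist_zero_right,
    Set.mem_ofPred_eq, exists_exists_and_eq_and]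
  constructor
  · rintro ⟨u, hu, rfl⟩
    rwa [add_sub_cancel_right, ← toEuclideanLin_mul_apply, Matrix.nonsing_inv_mul _ hS,
      toEuclideanLin_one_apply]
  · intro h
    refine ⟨_, h, ?_⟩
    rw [← toEuclideanLin_mul_apply, Matrix.mul_nonsing_inv _ hS, toEuclideanLin_one_apply,
      sub_add_cancel]

theorem quantumBlob_eq_quadForm {ħ : ℝ} (hħ : 0 ≤ ħ) (z₀ : PhaseSpace n)
    {S : Matrix (Fin n ⊕ Fin n) (Fin n ⊕ Fin n) ℝ} (hS : IsUnit S.det) :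
    quantumBlob ħ z₀ S = {z | quadForm ((S⁻¹)ᵀ * S⁻¹) (z - z₀) ≤ ħ} := by
  rw [quantumBlob_eq z₀ hS]
  ext z
  simp only [Set.mem_ofPred_eq, quadForm_transpose_mul_self]
  exact Real.le_sqrt (norm_nonneg _) hħ

theorem image_quantumBlob (ħ : ℝ) (z₀ : PhaseSpace n)
    (S T : Matrix (Fin n ⊕ Fin n) (Fin n ⊕ Fin n) ℝ) :
    Matrix.toEuclideanLin T '' quantumBlob ħ z₀ S =
      quantumBlob ħ (Matrix.toEuclideanLin T z₀) (T * S) := by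
  ext z
  simp only [quantumBlob, Set.mem_image, exists_exists_and_eq_and, map_add,
    toEuclideanLin_mul_apply]

/-- Every `X + iY` with `X` positive definite comes from a symplectic matrix. -/
theorem exists_symplectic_blobMatrix {X Y : Matrix (Fin n) (Fin n) ℝ} (hX : X.PosDef)
    (hY : Y.IsSymm) : ∃ M ∈ Matrix.symplecticGroup (Fin n) ℝ, Mᵀ * M = blobMatrix X Y := by
  obtain ⟨P, hP, rfl⟩ := exists_transpose_mul_self hX
  have hPT : IsUnit Pᵀ.det := by rwa [Matrix.det_transpose]
  have h1 : Pᵀ * P⁻¹ᵀ = 1 := by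
    rw [← Matrix.transpose_mul, Matrix.nonsing_inv_mul _ hP, Matrix.transpose_one]
  -- With `X = Pᵀ P`, this is the dilation `diag(P, P⁻ᵀ)` times the shear `(x, p) ↦ (x, p + Yx)`,
  -- both symplectic.
  refine ⟨Matrix.fromBlocks P 0 (P⁻¹ᵀ * Y) P⁻¹ᵀ, ?_, ?_⟩
  · rw [SymplecticGroup.fromBlocks_mem_iff]
    refine ⟨?_, by simp, by simp [h1]⟩
    rw [← mul_assoc, h1, one_mul, Matrix.transpose_mul, Matrix.transpose_transpose, hY.eq,
      mul_assoc, Matrix.nonsing_inv_mul _ hP, mul_one]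
  · rw [Matrix.fromBlocks_transpose, Matrix.fromBlocks_multiply, blobMatrix, Matrix.mul_inv_rev]
    simp [hY.eq, Matrix.transpose_nonsing_inv, mul_assoc]

theorem posDef_blobMatrix {X Y : Matrix (Fin n) (Fin n) ℝ} (hX : X.PosDef) (hY : Y.IsSymm) :
    (blobMatrix X Y).PosDef := by
  obtain ⟨M, hM, h⟩ := exists_symplectic_blobMatrix hX hY
  exact h ▸ posDef_transpose_mul_self (SymplecticGroup.symplectic_det hM)

theorem blobMatrix_mem_symplecticGroup {X Y : Matrix (Fin n) (Fin n) ℝ} (hX : X.PosDef)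
    (hY : Y.IsSymm) : blobMatrix X Y ∈ Matrix.symplecticGroup (Fin n) ℝ := by
  obtain ⟨M, hM, h⟩ := exists_symplectic_blobMatrix hX hY
  exact h ▸ mul_mem (SymplecticGroup.transpose_mem hM) hM

theorem symplectic_inv_mem {S : Matrix (Fin n ⊕ Fin n) (Fin n ⊕ Fin n) ℝ}
    (hS : S ∈ Matrix.symplecticGroup (Fin n) ℝ) : S⁻¹ ∈ Matrix.symplecticGroup (Fin n) ℝ := by
  have := SymplecticGroup.coe_inv' (⟨S, hS⟩ : Matrix.symplecticGroup (Fin n) ℝ)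
  rw [← this]
  exact Subtype.property _

/-- The real part `X` of the covariance data of a positive definite symplectic matrix. -/
def blobX (G : Matrix (Fin n ⊕ Fin n) (Fin n ⊕ Fin n) ℝ) : Matrix (Fin n) (Fin n) ℝ :=
  G.toBlocks₂₂⁻¹

/-- The imaginary part `Y` of the covariance data of a positive definite symplectic matrix. -/
def blobY (G : Matrix (Fin n ⊕ Fin n) (Fin n ⊕ Fin n) ℝ) : Matrix (Fin n) (Fin n) ℝ :=
  G.toBlocks₂₂⁻¹ * G.toBlocks₂₁

theorem blobX_blobMatrix {X : Matrix (Fin n) (Fin n) ℝ} (Y : Matrix (Fin n) (Fin n) ℝ)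
    (hX : X.PosDef) : blobX (blobMatrix X Y) = X := by
  simp [blobX, blobMatrix, Matrix.nonsing_inv_nonsing_inv _ (isUnit_det_of_posDef hX)]

theorem blobY_blobMatrix {X : Matrix (Fin n) (Fin n) ℝ} (Y : Matrix (Fin n) (Fin n) ℝ)
    (hX : X.PosDef) : blobY (blobMatrix X Y) = Y := by
  have h := isUnit_det_of_posDef hX
  simp only [blobY, blobMatrix, Matrix.toBlocks_fromBlocks₂₂, Matrix.toBlocks_fromBlocks₂₁,
    Matrix.nonsing_inv_nonsing_inv _ h]
  rw [← mul_assoc, Matrix.mul_nonsing_inv _ h, one_mul]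

section

variable {G : Matrix (Fin n ⊕ Fin n) (Fin n ⊕ Fin n) ℝ}

theorem posDef_toBlocks₂₂ (hG : G.PosDef) : G.toBlocks₂₂.PosDef :=
  hG.submatrix (e := Sum.inr) Sum.inr_injective

theorem posDef_blobX (hG : G.PosDef) : (blobX G).PosDef :=
  (posDef_toBlocks₂₂ hG).inv

/-- For a symmetric `G` with blocks `A`, `B`, `Bᵀ`, `D`, symplecticity amounts to relations that
leave only the lower blocks free: `Bᵀ D = D B` says that `D⁻¹ Bᵀ` is symmetric, and `A D - B B = 1`
recovers `A`. Positivity is used to invert `D`. -/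
theorem isSymm_blobY_and_blobMatrix_eq (hG : G.PosDef)
    (hGs : G ∈ Matrix.symplecticGroup (Fin n) ℝ) :
    (blobY G).IsSymm ∧ blobMatrix (blobX G) (blobY G) = G := by
  have hD := posDef_toBlocks₂₂ hG
  have hu := isUnit_det_of_posDef hD
  have hsym := isSymm_of_posDef hG
  unfold blobX blobY
  obtain ⟨A, B, C, D, rfl⟩ : ∃ A B C D, G = Matrix.fromBlocks A B C D :=
    ⟨_, _, _, _, (Matrix.fromBlocks_toBlocks G).symm⟩
  rw [Matrix.isSymm_fromBlocks_iff] at hsym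
  obtain ⟨hA, rfl, hCB, hDs⟩ := hsym
  rw [SymplecticGroup.fromBlocks_mem_iff] at hGs
  obtain ⟨-, h2, h3⟩ := hGs
  simp only [Matrix.toBlocks_fromBlocks₂₂, Matrix.toBlocks_fromBlocks₂₁] at hu ⊢
  rw [Matrix.transpose_transpose, hA.eq] at h3
  rw [hDs.eq] at h2
  have h4 : D⁻¹ * Bᵀ = B * D⁻¹ := by
    have : D⁻¹ * (Bᵀ * D) * D⁻¹ = D⁻¹ * (D * B) * D⁻¹ := by rw [h2]
    simpa only [mul_assoc, Matrix.mul_nonsing_inv _ hu, mul_one,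
      Matrix.nonsing_inv_mul_cancel_left _ _ hu] using this
  refine ⟨?_, ?_⟩
  · rw [Matrix.IsSymm, Matrix.transpose_mul, Matrix.transpose_transpose,
      Matrix.transpose_nonsing_inv, hDs.eq, h4]
  · have h5 : D⁻¹ + D⁻¹ * Bᵀ * D * (D⁻¹ * Bᵀ) = A := by
      rw [h4, mul_assoc B, Matrix.nonsing_inv_mul _ hu, mul_one, ← mul_assoc]
      have : (A * D - B * B) * D⁻¹ = D⁻¹ := by rw [h3, one_mul]
      rw [sub_mul, mul_assoc, Matrix.mul_nonsing_inv _ hu, mul_one] at this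
      exact (sub_eq_iff_eq_add.1 this).symm
    rw [blobMatrix, Matrix.nonsing_inv_nonsing_inv _ hu, h5]
    congr 1
    · rw [h4, mul_assoc, Matrix.nonsing_inv_mul _ hu, mul_one]
    · rw [← mul_assoc, Matrix.mul_nonsing_inv _ hu, one_mul]

end

/-! ### Transport of ellipsoids and the Riccati equation -/

section Riccati

/-- The matrix of the ellipsoid transported by the classical flow. -/
def transportedMatrix (R G : Matrix (Fin n ⊕ Fin n) (Fin n ⊕ Fin n) ℝ) (t : ℝ) :
    Matrix (Fin n ⊕ Fin n) (Fin n ⊕ Fin n) ℝ :=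
  (classicalFlow R (-t))ᵀ * G * classicalFlow R (-t)

variable {R G : Matrix (Fin n ⊕ Fin n) (Fin n ⊕ Fin n) ℝ}

theorem transportedMatrix_zero : transportedMatrix R G 0 = G := by
  simp [transportedMatrix, classicalFlow_zero]

theorem posDef_transportedMatrix (hG : G.PosDef) (t : ℝ) : (transportedMatrix R G t).PosDef := by
  have := hG.conjTranspose_mul_mul_same (B := classicalFlow R (-t))
    (Matrix.mulVec_injective_iff_isUnit.2 ?_)
  · simpa [transportedMatrix] using this
  · rw [Matrix.isUnit_iff_isUnit_det]
    refine Matrix.isUnit_det_of_right_inverse (B := classicalFlow R t) ?_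
    exact classicalFlow_neg_mul R t

theorem transportedMatrix_mem_symplecticGroup (hR : R.IsSymm)
    (hG : G ∈ Matrix.symplecticGroup (Fin n) ℝ) (t : ℝ) :
    transportedMatrix R G t ∈ Matrix.symplecticGroup (Fin n) ℝ :=
  mul_mem (mul_mem (SymplecticGroup.transpose_mem (classicalFlow_mem_symplecticGroup R hR _)) hG)
    (classicalFlow_mem_symplecticGroup R hR _)

theorem quadForm_transportedMatrix (t : ℝ) (v : PhaseSpace n) :
    quadForm (transportedMatrix R G t) (Matrix.toEuclideanLin (classicalFlow R t) v) =
      quadForm G v := by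
  rw [transportedMatrix, quadForm_congr, ← toEuclideanLin_mul_apply, classicalFlow_neg_mul,
    toEuclideanLin_one_apply]

theorem hasDerivAt_transportedMatrix (t : ℝ) :
    HasDerivAt (transportedMatrix R G)
      (-((standardJ n * R)ᵀ * transportedMatrix R G t +
        transportedMatrix R G t * (standardJ n * R))) t := by
  have h0 := hasDerivAt_classicalFlow_neg R t
  have h1 := hasDerivAt_matrix_mul (hasDerivAt_matrix_mul (hasDerivAt_matrix_transpose h0)
    (hasDerivAt_matrix_const G t)) h0
  convert! h1 using 1
  simp only [transportedMatrix, Matrix.transpose_neg, Matrix.transpose_mul, mul_zero, add_zero,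
    neg_mul, mul_neg, mul_assoc, neg_add]

theorem standardJ_mul_eq (hR : R.IsSymm) :
    standardJ n * R = Matrix.fromBlocks R.toBlocks₁₂ᵀ R.toBlocks₂₂ (-R.toBlocks₁₁)
      (-R.toBlocks₁₂) := by
  have h21 : R.toBlocks₂₁ = R.toBlocks₁₂ᵀ := by
    ext i j
    exact (hR.apply _ _).symm
  conv_lhs => rw [← Matrix.fromBlocks_toBlocks R]
  rw [standardJ, Matrix.fromBlocks_multiply, h21]
  simp

/-- The covariance data of a transported ellipsoid satisfy a matrix Riccati equation. -/
theorem hasDerivAt_blobX_blobY (hR : R.IsSymm) (hG : G.PosDef)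
    (hGs : G ∈ Matrix.symplecticGroup (Fin n) ℝ) (t : ℝ) :
    let A := R.toBlocks₁₁
    let B := R.toBlocks₁₂
    let D := R.toBlocks₂₂
    let X := fun s => blobX (transportedMatrix R G s)
    let Y := fun s => blobY (transportedMatrix R G s)
    HasDerivAt X (X t * D * Y t + Y t * D * X t - B * X t - X t * Bᵀ) t ∧
    HasDerivAt Y (A - B * Y t - Y t * Bᵀ - X t * D * X t + Y t * D * Y t) t := by
  intro A B D X Y
  have hGt := posDef_transportedMatrix (R := R) hG t
  obtain ⟨hYs, hE⟩ := isSymm_blobY_and_blobMatrix_eq hGt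
    (transportedMatrix_mem_symplecticGroup hR hGs t)
  have hX := posDef_blobX hGt
  have hu : IsUnit (X t).det := isUnit_det_of_posDef hX
  have hd := hasDerivAt_transportedMatrix (R := R) (G := G) t
  have hD : Dᵀ = D := by ext i j; exact hR.apply _ _
  have hBD := hd
  rw [← hE, blobMatrix, standardJ_mul_eq hR, Matrix.fromBlocks_transpose,
    Matrix.fromBlocks_multiply, Matrix.fromBlocks_multiply, Matrix.fromBlocks_add] at hBD
  change HasDerivAt _ (-Matrix.fromBlocks _ _ (Dᵀ * (X t + Y t * (X t)⁻¹ * Y t) +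
    (-B)ᵀ * ((X t)⁻¹ * Y t) + ((X t)⁻¹ * Y t * Bᵀ + (X t)⁻¹ * -A)) (Dᵀ * (Y t * (X t)⁻¹) +
    (-B)ᵀ * (X t)⁻¹ + ((X t)⁻¹ * Y t * D + (X t)⁻¹ * -B))) _ at hBD
  have hT : (transportedMatrix R G t).toBlocks₂₂ = (X t)⁻¹ := by
    rw [← hE, blobMatrix, Matrix.toBlocks_fromBlocks₂₂]
  have hC : (transportedMatrix R G t).toBlocks₂₁ = (X t)⁻¹ * Y t := by
    rw [← hE, blobMatrix, Matrix.toBlocks_fromBlocks₂₁]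
  -- Since `X = G₂₂⁻¹` and `Y = X G₂₁`, only the lower blocks of the linear equation for `G_t` are
  -- needed.
  have h22 : HasDerivAt (fun s => (transportedMatrix R G s).toBlocks₂₂)
      (-(Dᵀ * (Y t * (X t)⁻¹) + (-B)ᵀ * (X t)⁻¹ + ((X t)⁻¹ * Y t * D + (X t)⁻¹ * -B))) t := by
    rw [hasDerivAt_matrix_iff] at hBD ⊢
    exact fun i j => hBD (Sum.inr i) (Sum.inr j)
  have h21 : HasDerivAt (fun s => (transportedMatrix R G s).toBlocks₂₁)
      (-(Dᵀ * (X t + Y t * (X t)⁻¹ * Y t) + (-B)ᵀ * ((X t)⁻¹ * Y t) +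
        ((X t)⁻¹ * Y t * Bᵀ + (X t)⁻¹ * -A))) t := by
    rw [hasDerivAt_matrix_iff] at hBD ⊢
    exact fun i j => hBD (Sum.inr i) (Sum.inl j)
  have hX' : HasDerivAt X (X t * D * Y t + Y t * D * X t - B * X t - X t * Bᵀ) t := by
    have h := hasDerivAt_matrix_inv h22 (by rw [hT, Matrix.isUnit_nonsing_inv_iff]; exact hX.isUnit)
    convert! h using 1
    rw [hT, Matrix.nonsing_inv_nonsing_inv _ hu, hD, Matrix.transpose_neg]
    simp only [mul_add, add_mul, mul_neg, neg_mul, mul_assoc, neg_neg,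
      Matrix.nonsing_inv_mul _ hu, mul_one, Matrix.mul_nonsing_inv_cancel_left _ _ hu]
    abel
  refine ⟨hX', ?_⟩
  have h := hasDerivAt_matrix_mul hX' h21
  convert! h using 1
  rw [hC, hD, Matrix.transpose_neg]
  simp only [mul_add, add_mul, sub_mul, mul_neg, neg_mul, mul_assoc, neg_neg,
    Matrix.mul_nonsing_inv_cancel_left _ _ hu, neg_add]
  abel

end Riccati

/-! ### Gaussian integrals with a matrix covariance -/

section GaussianIntegral

theorem integral_comp_toEuclideanLin {P : Matrix (Fin n) (Fin n) ℝ} (hP : IsUnit P.det)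
    (f : ConfigSpace n → ℂ) :
    ∫ y, f (Matrix.toEuclideanLin P y) = ((|P.det|⁻¹ : ℝ) : ℂ) * ∫ y, f y := by
  have hdet : LinearMap.det (Matrix.toEuclideanLin P) = P.det := LinearMap.det_toLpLin 2 P
  have h0 : LinearMap.det (Matrix.toEuclideanLin P) ≠ 0 := hdet ▸ hP.ne_zero
  have hemb : MeasurableEmbedding (Matrix.toEuclideanLin P : ConfigSpace n → ConfigSpace n) :=
    (((Matrix.toEuclideanLin P).equivOfDetNeZero h0).toContinuousLinearEquiv.toHomeomorph
      |>.measurableEmbedding)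
  rw [← hemb.integral_map, Measure.map_linearMap_addHaar_eq_smul_addHaar volume h0,
    integral_smul_measure, ENNReal.toReal_ofReal (abs_nonneg _), hdet, abs_inv]
  simp

theorem sqrt_det_transpose_mul_self {P : Matrix (Fin n) (Fin n) ℝ} :
    (Pᵀ * P).det ^ (-(1 / 2) : ℝ) = |P.det|⁻¹ := by
  rw [Matrix.det_mul, Matrix.det_transpose, ← sq, ← sq_abs, Real.rpow_neg (by positivity),
    ← Real.sqrt_eq_rpow, Real.sqrt_sq (abs_nonneg _)]

/-- The Fourier--Laplace transform of a real Gaussian on `ℝⁿ`. -/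
theorem integral_gaussian_quadForm {X : Matrix (Fin n) (Fin n) ℝ} (hX : X.PosDef) {b : ℝ}
    (hb : 0 < b) (c : ℂ) (k : ConfigSpace n) :
    ∫ y : ConfigSpace n, Complex.exp (-(b * quadForm X y : ℝ) + c * (inner ℝ k y : ℝ)) =
      (((Real.pi / b) ^ (n / 2 : ℝ) * X.det ^ (-(1 / 2) : ℝ) : ℝ) : ℂ) *
        Complex.exp (c ^ 2 * (quadForm X⁻¹ k : ℝ) / (4 * b)) := by
  -- The substitution `u = P y` with `X = Pᵀ P` makes the Gaussian isotropic; it turns the frequency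
  -- `k` into `P⁻ᵀ k`, whose squared norm is `X⁻¹ k · k`.
  obtain ⟨P, hP, rfl⟩ := exists_transpose_mul_self hX
  have hk : ∀ y, inner ℝ k y =
      inner ℝ (Matrix.toEuclideanLin P⁻¹ᵀ k) (Matrix.toEuclideanLin P y) := by
    intro y
    rw [inner_toEuclideanLin_left, Matrix.transpose_transpose, ← toEuclideanLin_mul_apply,
      Matrix.nonsing_inv_mul _ hP, toEuclideanLin_one_apply]
  have hq : quadForm (Pᵀ * P)⁻¹ k = ‖Matrix.toEuclideanLin P⁻¹ᵀ k‖ ^ 2 := by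
    rw [← quadForm_transpose_mul_self, Matrix.transpose_transpose, Matrix.mul_inv_rev,
      Matrix.transpose_nonsing_inv]
  simp_rw [quadForm_transpose_mul_self, hk]
  have h := integral_comp_toEuclideanLin hP (fun u : ConfigSpace n =>
    Complex.exp (-(b * ‖u‖ ^ 2 : ℝ) +
      c * (inner ℝ (Matrix.toEuclideanLin P⁻¹ᵀ k) u : ℝ)))
  rw [h, sqrt_det_transpose_mul_self, hq]
  have h2 := GaussianFourier.integral_cexp_neg_mul_sq_norm_add (b := (b : ℂ)) (by simpa using hb) c
    (Matrix.toEuclideanLin P⁻¹ᵀ k)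
  have h3 : (((Real.pi / b) ^ (n / 2 : ℝ) : ℝ) : ℂ) =
      ((Real.pi : ℂ) / b) ^ (Module.finrank ℝ (ConfigSpace n) / 2 : ℂ) := by
    rw [Complex.ofReal_cpow (by positivity)]
    simp
  rw [Complex.ofReal_mul, h3]
  simp only [Complex.ofReal_mul, Complex.ofReal_pow, ← neg_mul]
  rw [h2]
  ring

end GaussianIntegral

/-! ### Wigner transforms of squeezed coherent states -/

section Wigner

theorem inner_position_momentum (u v : PhaseSpace n) :
    inner ℝ u v = inner ℝ (position u) (position v) + inner ℝ (momentum u) (momentum v) := by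
  simp [PiLp.inner_apply, position, momentum, Fintype.sum_sum_type]

theorem position_sub (z w : PhaseSpace n) : position (z - w) = position z - position w := rfl

theorem momentum_sub (z w : PhaseSpace n) : momentum (z - w) = momentum z - momentum w := rfl

/-- Completion of the square in the momentum. The Wigner integral produces exactly these two terms:
the first from the midpoint, the second from the Fourier transform in the relative variable. -/
theorem quadForm_blobMatrix {X Y : Matrix (Fin n) (Fin n) ℝ} (hX : X.PosDef) (hY : Y.IsSymm)
    (w : PhaseSpace n) :
    quadForm (blobMatrix X Y) w = quadForm X (position w) +
      quadForm X⁻¹ (momentum w + Matrix.toEuclideanLin Y (position w)) := by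
  have hXi : X⁻¹.IsSymm := isSymm_of_posDef hX.inv
  have hp : position (Matrix.toEuclideanLin (blobMatrix X Y) w) =
      Matrix.toEuclideanLin X (position w) + Matrix.toEuclideanLin Y (Matrix.toEuclideanLin X⁻¹
        (momentum w + Matrix.toEuclideanLin Y (position w))) := by
    apply WithLp.ofLp_injective
    have := Matrix.fromBlocks_mulVec (X + Y * X⁻¹ * Y) (Y * X⁻¹) (X⁻¹ * Y) X⁻¹ w.ofLp
    ext j
    simp only [position, blobMatrix, Matrix.ofLp_toLpLin, Matrix.toLin'_apply, this,
      Sum.elim_inl]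
    simp only [momentum, WithLp.ofLp_add, Matrix.mulVec_add, Matrix.ofLp_toLpLin,
      Matrix.toLin'_apply, Matrix.mulVec_mulVec, Matrix.add_mulVec, Pi.add_apply, mul_assoc]
    simp only [Function.comp_def]
    ring
  have hm : momentum (Matrix.toEuclideanLin (blobMatrix X Y) w) =
      Matrix.toEuclideanLin X⁻¹ (momentum w + Matrix.toEuclideanLin Y (position w)) := by
    apply WithLp.ofLp_injective
    have := Matrix.fromBlocks_mulVec (X + Y * X⁻¹ * Y) (Y * X⁻¹) (X⁻¹ * Y) X⁻¹ w.ofLp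
    ext j
    simp only [position, momentum, blobMatrix, Matrix.ofLp_toLpLin, Matrix.toLin'_apply, this,
      Sum.elim_inr, WithLp.ofLp_add, Matrix.mulVec_add, Matrix.mulVec_mulVec, Pi.add_apply]
    simp only [Function.comp_def]
    ring
  rw [quadForm_eq_inner, inner_position_momentum, hp, hm, inner_add_left, quadForm_eq_inner,
    quadForm_eq_inner, inner_add_right, inner_toEuclideanLin_left Y, hY.eq]
  ring

theorem quadForm_parallelogram {A : Matrix (Fin n) (Fin n) ℝ} (hA : A.IsSymm)
    (u y : ConfigSpace n) :
    quadForm A (u + (1 / 2 : ℝ) • y) + quadForm A (u - (1 / 2 : ℝ) • y) =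
      2 * quadForm A u + 1 / 2 * quadForm A y := by
  rw [sub_eq_add_neg, quadForm_add A hA, quadForm_add A hA, quadForm_neg, quadForm_smul,
    inner_neg_right]
  ring

theorem quadForm_add_sub {A : Matrix (Fin n) (Fin n) ℝ} (hA : A.IsSymm) (u y : ConfigSpace n) :
    quadForm A (u + (1 / 2 : ℝ) • y) - quadForm A (u - (1 / 2 : ℝ) • y) =
      2 * inner ℝ (Matrix.toEuclideanLin A u) y := by
  rw [sub_eq_add_neg u, quadForm_add A hA, quadForm_add A hA, quadForm_neg, quadForm_smul,
    inner_neg_right, real_inner_smul_right]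
  ring

/-- The wavefunction `e^{iγ/ħ} T̂(z₀) Φ_{X,Y}`. -/
def coherentState (ħ : ℝ) (X Y : Matrix (Fin n) (Fin n) ℝ) (z₀ : PhaseSpace n) (γ : ℝ)
    (x : ConfigSpace n) : ℂ :=
  Complex.exp (Complex.I / (ħ : ℂ) * (γ : ℂ)) * heisenbergWeyl ħ z₀ (squeezedGaussian ħ X Y) x

/-- The exponents of the two factors add up to a sum for `X` and a difference for `Y`. The
parallelogram law decouples midpoint and relative variable in the first, and the second is linear in
`y`. As a function of `y` the Wigner integrand is therefore a real Gaussian times a character. -/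
theorem coherentState_mul_conj (ħ : ℝ) {X Y : Matrix (Fin n) (Fin n) ℝ} (hX : X.IsSymm)
    (hY : Y.IsSymm) (z₀ : PhaseSpace n) (γ : ℝ) (x y : ConfigSpace n) :
    coherentState ħ X Y z₀ γ (x + (1 / 2 : ℝ) • y) *
        (starRingEnd ℂ) (coherentState ħ X Y z₀ γ (x - (1 / 2 : ℝ) • y)) =
      ((((Real.pi * ħ) ^ (-(n : ℝ) / 4) * X.det ^ (1 / 4 : ℝ)) ^ 2 : ℝ) : ℂ) *
      Complex.exp (-(1 / ħ * quadForm X (x - position z₀) : ℝ)) *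
      Complex.exp (-(1 / (4 * ħ) * quadForm X y : ℝ) + Complex.I / ħ *
        (inner ℝ (momentum z₀ - Matrix.toEuclideanLin Y (x - position z₀)) y : ℝ)) := by
  set a : ℝ := (Real.pi * ħ) ^ (-(n : ℝ) / 4) * X.det ^ (1 / 4 : ℝ)
  set u := x - position z₀
  have h1 : x + (1 / 2 : ℝ) • y - position z₀ = u + (1 / 2 : ℝ) • y := by simp only [u]; abel
  have h2 : x - (1 / 2 : ℝ) • y - position z₀ = u - (1 / 2 : ℝ) • y := by simp only [u]; abel
  have h3 := quadForm_parallelogram hX u y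
  have h4 := quadForm_add_sub hY u y
  simp only [coherentState, heisenbergWeyl, squeezedGaussian, h1, h2, map_mul, ← Complex.exp_conj,
    Complex.conj_ofReal, map_div₀, Complex.conj_I, map_neg, map_add, map_ofNat, map_one]
  rw [show ∀ e1 e2 e3 f1 f2 f3 A : ℂ, Complex.exp e1 * (Complex.exp e2 * (A * Complex.exp e3)) *
    (Complex.exp f1 * (Complex.exp f2 * (A * Complex.exp f3))) =
      A ^ 2 * Complex.exp (e1 + f1 + e2 + f2 + e3 + f3) by
    intros; simp only [Complex.exp_add]; ring, mul_assoc, ← Complex.exp_add, Complex.ofReal_pow]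
  congr 2
  rw [inner_sub_left, inner_add_right, inner_sub_right, real_inner_smul_right]
  have h3' := congrArg (fun r : ℝ => (r : ℂ)) h3
  have h4' := congrArg (fun r : ℝ => (r : ℂ)) h4
  push_cast at h3' h4' ⊢
  linear_combination (-(1 / (2 * (ħ : ℂ)))) * h3' - Complex.I / (2 * (ħ : ℂ)) * h4'

theorem coherentState_normalization {ħ : ℝ} (hħ : 0 < ħ) {X : Matrix (Fin n) (Fin n) ℝ}
    (hX : X.PosDef) :
    (1 / (2 * Real.pi * ħ)) ^ n * (((Real.pi * ħ) ^ (-(n : ℝ) / 4) * X.det ^ (1 / 4 : ℝ)) ^ 2 *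
      ((Real.pi / (1 / (4 * ħ))) ^ (n / 2 : ℝ) * X.det ^ (-(1 / 2) : ℝ))) =
      (1 / (Real.pi * ħ)) ^ n := by
  have hd : 0 < X.det := hX.det_pos
  have hπ : 0 < Real.pi * ħ := by positivity
  have e1 : Real.pi / (1 / (4 * ħ)) = 2 ^ (2 : ℝ) * (Real.pi * ħ) := by
    rw [one_div, div_inv_eq_mul, Real.rpow_two]; ring
  have e2 : 1 / (2 * Real.pi * ħ) = 1 / 2 * (1 / (Real.pi * ħ)) := by
    rw [mul_assoc, one_div_mul_one_div]
  have e3 : ((Real.pi * ħ) ^ (-(n : ℝ) / 4)) ^ 2 * (Real.pi * ħ) ^ (n / 2 : ℝ) = 1 := by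
    rw [← Real.rpow_mul_natCast hπ.le, ← Real.rpow_add hπ]
    rw [show (-(n : ℝ) / 4 * (2 : ℕ) + n / 2) = 0 by push_cast; ring, Real.rpow_zero]
  have e4 : (X.det ^ (1 / 4 : ℝ)) ^ 2 * X.det ^ (-(1 / 2) : ℝ) = 1 := by
    rw [← Real.rpow_mul_natCast hd.le, ← Real.rpow_add hd]
    norm_num
  have e5 : ((2 : ℝ) ^ (2 : ℝ)) ^ (n / 2 : ℝ) = 2 ^ n := by
    rw [← Real.rpow_mul two_pos.le, show (2 * (n / 2) : ℝ) = n by ring, Real.rpow_natCast]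
  rw [e1, e2, mul_pow, mul_pow, Real.mul_rpow (by positivity) hπ.le, e5]
  have e6 : (1 / 2 : ℝ) ^ n * 2 ^ n = 1 := by rw [← mul_pow]; norm_num
  linear_combination (1 / (Real.pi * ħ)) ^ n * ((1 / 2 : ℝ) ^ n * 2 ^ n *
    (X.det ^ (1 / 4 : ℝ)) ^ 2 * X.det ^ (-(1 / 2) : ℝ) * e3 + (1 / 2 : ℝ) ^ n * 2 ^ n * e4 + e6)

theorem wigner_coherentState {ħ : ℝ} (hħ : 0 < ħ) {X Y : Matrix (Fin n) (Fin n) ℝ}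
    (hX : X.PosDef) (hY : Y.IsSymm) (z₀ : PhaseSpace n) (γ : ℝ) (z : PhaseSpace n) :
    wigner ħ (coherentState ħ X Y z₀ γ) z =
      (((1 / (Real.pi * ħ)) ^ n *
        Real.exp (-(1 / ħ) * quadForm (blobMatrix X Y) (z - z₀)) : ℝ) : ℂ) := by
  set u := position z - position z₀ with hu
  set k := momentum (z - z₀) + Matrix.toEuclideanLin Y u with hk
  have hint : ∀ y, Complex.exp (-(Complex.I / (ħ : ℂ)) * ((inner ℝ (momentum z) y : ℝ) : ℂ)) *
        coherentState ħ X Y z₀ γ (position z + (1 / 2 : ℝ) • y) *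
        (starRingEnd ℂ) (coherentState ħ X Y z₀ γ (position z - (1 / 2 : ℝ) • y)) =
      ((((Real.pi * ħ) ^ (-(n : ℝ) / 4) * X.det ^ (1 / 4 : ℝ)) ^ 2 : ℝ) : ℂ) *
      Complex.exp (-(1 / ħ * quadForm X u : ℝ)) *
      Complex.exp (-(1 / (4 * ħ) * quadForm X y : ℝ) + -(Complex.I / ħ) * (inner ℝ k y : ℝ)) := by
    intro y
    rw [mul_assoc, coherentState_mul_conj ħ (isSymm_of_posDef hX) hY, mul_left_comm,
      ← Complex.exp_add]
    congr 2
    rw [hk, momentum_sub, inner_add_left, inner_sub_left, inner_sub_left]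
    push_cast
    ring
  unfold wigner
  simp_rw [hint]
  rw [integral_const_mul, integral_gaussian_quadForm hX (by positivity),
    quadForm_blobMatrix hX hY, position_sub, ← hu, ← hk, ← coherentState_normalization hħ hX]
  have hħ' : (ħ : ℂ) ≠ 0 := by exact_mod_cast hħ.ne'
  have he : (-(Complex.I / (ħ : ℂ))) ^ 2 * ((quadForm X⁻¹ k : ℝ) : ℂ) /
      (4 * ((1 / (4 * ħ) : ℝ) : ℂ)) = ((-(1 / ħ) * quadForm X⁻¹ k : ℝ) : ℂ) := by
    push_cast
    rw [neg_sq, div_pow, Complex.I_sq]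
    field_simp
  rw [he, mul_add, Real.exp_add]
  push_cast
  ring_nf

/-- Needed because states are classes modulo null sets. For a fixed `z`, the maps `y ↦ x ± y/2` pull
null sets back to null sets. -/
theorem wigner_congr {ħ : ℝ} {f g : ConfigSpace n → ℂ} (h : f =ᵐ[volume] g) (z : PhaseSpace n) :
    wigner ħ f z = wigner ħ g z := by
  unfold wigner
  congr 1
  have hs : ∀ c : ℝ, c ≠ 0 → Measure.QuasiMeasurePreserving (fun y : ConfigSpace n => c • y)
      volume volume := by
    intro c hc
    refine ⟨measurable_const_smul _, ?_⟩
    rw [Measure.map_addHaar_smul volume hc]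
    exact Measure.smul_absolutelyContinuous
  have h1 := ((hs (1 / 2) (by norm_num)).ae_eq_comp ((measurePreserving_add_left volume
    (position z)).quasiMeasurePreserving.ae_eq_comp h))
  have h2 := ((hs (-(1 / 2)) (by norm_num)).ae_eq_comp ((measurePreserving_add_left volume
    (position z)).quasiMeasurePreserving.ae_eq_comp h))
  refine integral_congr_ae ?_
  filter_upwards [h1, h2] with y hy1 hy2
  simp only [Function.comp_apply, neg_smul, ← sub_eq_add_neg] at hy1 hy2
  rw [hy1, hy2]

/-- Two Gaussian representations of one Wigner transform have the same prefactor, so their exponents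
agree as functions of `z`; that already fixes the sublevel set, without comparing matrices or
centres. -/
theorem correspondsTo_iff_of_wigner {ħ : ℝ} (hħ : 0 < ħ) {ψ : StateSpace n}
    {G : Matrix (Fin n ⊕ Fin n) (Fin n ⊕ Fin n) ℝ} {z₀ : PhaseSpace n} (hG : G.PosDef)
    (hW : ∀ z : PhaseSpace n, wigner ħ ψ z =
      (((1 / (Real.pi * ħ)) ^ n * Real.exp (-(1 / ħ) * quadForm G (z - z₀)) : ℝ) : ℂ))
    (Q : Set (PhaseSpace n)) :
    CorrespondsTo ħ ψ Q ↔ Q = {z | quadForm G (z - z₀) ≤ ħ} := by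
  refine ⟨?_, fun h => ⟨G, z₀, hG, hW, h⟩⟩
  rintro ⟨G', z₁, -, hW', rfl⟩
  ext z
  have h := (hW z).symm.trans (hW' z)
  rw [Complex.ofReal_inj] at h
  have h1 := Real.exp_injective (mul_left_cancel₀ (by positivity) h)
  have h2 := mul_left_cancel₀ (by simpa using hħ.ne') h1
  simp only [Set.mem_ofPred_eq, h2]

theorem correspondsTo_coherentState_iff {ħ : ℝ} (hħ : 0 < ħ) {ψ : StateSpace n}
    {X Y : Matrix (Fin n) (Fin n) ℝ} (hX : X.PosDef) (hY : Y.IsSymm) {z₀ : PhaseSpace n} {γ : ℝ}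
    (hψ : ψ =ᵐ[volume] coherentState ħ X Y z₀ γ) (Q : Set (PhaseSpace n)) :
    CorrespondsTo ħ ψ Q ↔ Q = {z | quadForm (blobMatrix X Y) (z - z₀) ≤ ħ} :=
  correspondsTo_iff_of_wigner hħ (posDef_blobMatrix hX hY)
    (fun z => (wigner_congr hψ z).trans (wigner_coherentState hħ hX hY z₀ γ z)) Q

theorem norm_sq_coherentState (ħ : ℝ) {X Y : Matrix (Fin n) (Fin n) ℝ} (hX : X.IsSymm)
    (hY : Y.IsSymm) (z₀ : PhaseSpace n) (γ : ℝ) (x : ConfigSpace n) :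
    ‖coherentState ħ X Y z₀ γ x‖ ^ 2 =
      ((Real.pi * ħ) ^ (-(n : ℝ) / 4) * X.det ^ (1 / 4 : ℝ)) ^ 2 *
        Real.exp (-(1 / ħ * quadForm X (x - position z₀))) := by
  have h := coherentState_mul_conj ħ hX hY z₀ γ x 0
  simp only [smul_zero, add_zero, sub_zero, Complex.mul_conj, Complex.normSq_eq_norm_sq,
    inner_zero_right] at h
  have h0 : quadForm X (0 : ConfigSpace n) = 0 := by simp [quadForm]
  rw [h0] at h
  simp only [mul_zero, Complex.ofReal_zero, neg_zero, add_zero, Complex.exp_zero, mul_one] at h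
  exact_mod_cast h

theorem integral_norm_sq_coherentState {ħ : ℝ} (hħ : 0 < ħ) {X Y : Matrix (Fin n) (Fin n) ℝ}
    (hX : X.PosDef) (hY : Y.IsSymm) (z₀ : PhaseSpace n) (γ : ℝ) :
    ∫ x, ‖coherentState ħ X Y z₀ γ x‖ ^ 2 = 1 := by
  simp_rw [norm_sq_coherentState ħ (isSymm_of_posDef hX) hY]
  rw [integral_const_mul, integral_sub_right_eq_self
    (fun x => Real.exp (-(1 / ħ * quadForm X x))) (position z₀)]
  have h := integral_gaussian_quadForm hX (one_div_pos.2 hħ) 0 0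
  have hd : 0 < X.det := hX.det_pos
  have hπ : 0 < Real.pi * ħ := by positivity
  simp only [zero_mul, add_zero, ne_eq, OfNat.ofNat_ne_zero, not_false_eq_true, zero_pow,
    zero_div, Complex.exp_zero, mul_one] at h
  have h' : ∫ x : ConfigSpace n, Real.exp (-(1 / ħ * quadForm X x)) =
      (Real.pi / (1 / ħ)) ^ (n / 2 : ℝ) * X.det ^ (-(1 / 2) : ℝ) := by
    rw [← Complex.ofReal_inj, ← h, ← integral_complex_ofReal]
    simp
  have e3 : ((Real.pi * ħ) ^ (-(n : ℝ) / 4)) ^ 2 * (Real.pi * ħ) ^ (n / 2 : ℝ) = 1 := by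
    rw [← Real.rpow_mul_natCast hπ.le, ← Real.rpow_add hπ]
    rw [show (-(n : ℝ) / 4 * (2 : ℕ) + n / 2) = 0 by push_cast; ring, Real.rpow_zero]
  have e4 : (X.det ^ (1 / 4 : ℝ)) ^ 2 * X.det ^ (-(1 / 2) : ℝ) = 1 := by
    rw [← Real.rpow_mul_natCast hd.le, ← Real.rpow_add hd]
    norm_num
  rw [h', one_div ħ, div_inv_eq_mul]
  linear_combination (X.det ^ (1 / 4 : ℝ)) ^ 2 * X.det ^ (-(1 / 2) : ℝ) * e3 + e4

end Wigner

/-! ### Exponentials that are Schwartz functions -/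

section ExpSchwartz

open scoped ContDiff Nat

theorem exists_one_add_pow_mul_exp_le (m : ℕ) {c : ℝ} (hc : 0 < c) :
    ∃ K : ℝ, 0 ≤ K ∧ ∀ r : ℝ, 0 ≤ r → (1 + r) ^ m * Real.exp (-(c * r ^ 2)) ≤ K := by
  -- One term of the exponential series bounds `(1 + r) ^ m` by a multiple of `exp (c (1 + r))`, and
  -- `c (1 + r) - c r² ≤ 2c`.
  refine ⟨m ! / c ^ m * Real.exp (2 * c), by positivity, fun r hr => ?_⟩
  have h1 := Real.pow_div_factorial_le_exp (c * (1 + r)) (by positivity) m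
  have h2 : (1 + r) ^ m ≤ m ! / c ^ m * Real.exp (c * (1 + r)) := by
    rw [div_le_iff₀ (by positivity), mul_pow] at h1
    rw [div_mul_eq_mul_div, le_div_iff₀ (by positivity)]
    linarith
  calc (1 + r) ^ m * Real.exp (-(c * r ^ 2))
      ≤ m ! / c ^ m * Real.exp (c * (1 + r)) * Real.exp (-(c * r ^ 2)) := by gcongr
    _ = m ! / c ^ m * Real.exp (c * (1 + r) - c * r ^ 2) := by
        rw [mul_assoc, ← Real.exp_add, sub_eq_add_neg]
    _ ≤ _ := by
        gcongr
        nlinarith [sq_nonneg (2 * r - 1)]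

theorem norm_iteratedFDeriv_cexp_le (i : ℕ) (w : ℂ) :
    ‖iteratedFDeriv ℝ i Complex.exp w‖ ≤ ‖Complex.exp w‖ := by
  have h : ContDiffAt ℂ i Complex.exp w := Complex.contDiff_exp.contDiffAt
  have h1 : ‖iteratedFDeriv ℂ i Complex.exp w‖ = ‖Complex.exp w‖ := by
    rw [norm_iteratedFDeriv_eq_norm_iteratedDeriv, iteratedDeriv_eq_iterate,
      Complex.iter_deriv_exp]
  rw [← h.restrictScalars_iteratedFDeriv (𝕜 := ℝ)]
  simp only [Function.comp_apply, ContinuousMultilinearMap.norm_restrictScalars, h1, le_refl]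

variable {V : Type*} [NormedAddCommGroup V] [NormedSpace ℝ V]

theorem exp_decay {E : V → ℂ} (hE : E.HasTemperateGrowth) {C c : ℝ} (hc : 0 < c)
    (hre : ∀ x, (E x).re ≤ C - c * ‖x‖ ^ 2) (k n : ℕ) :
    ∃ K : ℝ, ∀ x, ‖x‖ ^ k * ‖iteratedFDeriv ℝ n (Complex.exp ∘ E) x‖ ≤ K := by
  obtain ⟨l, D, hD0, hD⟩ := hE.norm_iteratedFDeriv_le_uniform n
  obtain ⟨K, hK0, hK⟩ := exists_one_add_pow_mul_exp_le (k + l * n) hc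
  refine ⟨n ! * (1 + D) ^ n * Real.exp C * K, fun x => ?_⟩
  have h1 : 1 ≤ (1 + ‖x‖) ^ l := one_le_pow₀ (by linarith [norm_nonneg x])
  have h2 : 1 ≤ (1 + D) * (1 + ‖x‖) ^ l := one_le_mul_of_one_le_of_one_le (by linarith) h1
  -- The Faà di Bruno estimate asks for a bound `D ^ i` on the `i`-th derivative of `E`. Taking `1 +
  -- D` makes the base at least one, so its powers dominate the uniform bound when `i ≥ 1`.
  have h := norm_iteratedFDeriv_comp_le (𝕜 := ℝ) (g := Complex.exp) (f := E) (n := n) (N := ∞)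
    (Complex.contDiff_exp (𝕜 := ℝ)) hE.1 (by exact_mod_cast le_top) x
    (C := Real.exp (C - c * ‖x‖ ^ 2)) (D := (1 + D) * (1 + ‖x‖) ^ l)
    (fun i _ => (norm_iteratedFDeriv_cexp_le i _).trans
      (by rw [Complex.norm_exp]; exact Real.exp_le_exp.2 (hre x)))
    (fun i hi1 hi => by
      calc _ ≤ D * (1 + ‖x‖) ^ l := hD i hi x
        _ ≤ (1 + D) * (1 + ‖x‖) ^ l := by gcongr; linarith
        _ ≤ _ := le_self_pow₀ h2 (by omega))
  calc ‖x‖ ^ k * ‖iteratedFDeriv ℝ n (Complex.exp ∘ E) x‖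
      ≤ (1 + ‖x‖) ^ k * (n ! * Real.exp (C - c * ‖x‖ ^ 2) * ((1 + D) * (1 + ‖x‖) ^ l) ^ n) := by
        gcongr
        linarith
    _ = n ! * (1 + D) ^ n * Real.exp C *
        ((1 + ‖x‖) ^ (k + l * n) * Real.exp (-(c * ‖x‖ ^ 2))) := by
        rw [sub_eq_add_neg, Real.exp_add, mul_pow, pow_add, pow_mul]
        ring
    _ ≤ _ := by gcongr; exact hK _ (norm_nonneg x)

/-- The exponential of a function of temperate growth whose real part is bounded above by a
negative definite quadratic, as a Schwartz function. -/
def expSchwartz (E : V → ℂ) (hE : E.HasTemperateGrowth)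
    (hre : ∃ C c : ℝ, 0 < c ∧ ∀ x, (E x).re ≤ C - c * ‖x‖ ^ 2) : 𝓢(V, ℂ) where
  toFun := Complex.exp ∘ E
  smooth' := (Complex.contDiff_exp (𝕜 := ℝ)).comp hE.1
  decay' k n := by
    obtain ⟨C, c, hc, h⟩ := hre
    exact exp_decay hE hc h k n

theorem expSchwartz_apply (E : V → ℂ) (hE : E.HasTemperateGrowth)
    (hre : ∃ C c : ℝ, 0 < c ∧ ∀ x, (E x).re ≤ C - c * ‖x‖ ^ 2) (x : V) :
    expSchwartz E hE hre x = Complex.exp (E x) := rfl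

end ExpSchwartz

/-! ### Differentiating curves in `L²` under domination -/

section Differentiation

open Filter Topology

variable {α : Type*} [MeasurableSpace α] {μ : Measure α}

/-- Differentiation under the `L²` norm, for a dominated family of difference quotients. -/
theorem hasDerivAt_Lp_of_dominated {f : ℝ → α → ℂ} {f' : α → ℂ} {g : α → ℝ}
    {F : ℝ → Lp ℂ 2 μ} {F' : Lp ℂ 2 μ} {t₀ : ℝ} (hg : MemLp g 2 μ)
    (hF : ∀ t, F t =ᵐ[μ] f t) (hF' : F' =ᵐ[μ] f')
    (hd : ∀ x, HasDerivAt (fun t => f t x) (f' x) t₀)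
    (hb : ∀ᶠ t in 𝓝 t₀, ∀ x, ‖f t x - f t₀ x‖ ≤ |t - t₀| * g x) :
    HasDerivAt F F' t₀ := by
  have hslope : ∀ x, Tendsto (fun t => slope (fun t => f t x) t₀ t) (𝓝[≠] t₀) (𝓝 (f' x)) :=
    fun x => hasDerivAt_iff_tendsto_slope.1 (hd x)
  have hsb : ∀ᶠ t in 𝓝[≠] t₀, ∀ x, ‖slope (fun t => f t x) t₀ t‖ ≤ g x := by
    filter_upwards [hb.filter_mono nhdsWithin_le_nhds, self_mem_nhdsWithin] with t ht hne x
    have h0 : 0 < |t - t₀| := abs_pos.2 (sub_ne_zero.2 hne)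
    rw [slope_def_module, norm_smul, norm_inv, Real.norm_eq_abs, inv_mul_le_iff₀ h0]
    exact ht x
  -- The pointwise limit inherits the bound on the difference quotients, so the error `slope - f'`
  -- is dominated by `2 g`, which is square integrable.
  have hf'b : ∀ x, ‖f' x‖ ≤ g x := fun x =>
    le_of_tendsto (hslope x).norm (hsb.mono fun t ht => ht x)
  have hFs : ∀ t, (slope F t₀ t - F' : Lp ℂ 2 μ) =ᵐ[μ]
      fun x => slope (fun t => f t x) t₀ t - f' x := by
    intro t
    filter_upwards [Lp.coeFn_sub (slope F t₀ t) F', Lp.coeFn_smul (t - t₀)⁻¹ (F t - F t₀),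
      Lp.coeFn_sub (F t) (F t₀), hF t, hF t₀, hF'] with x h1 h2 h3 h4 h5 h6
    rw [h1, Pi.sub_apply, slope_def_module, h2, Pi.smul_apply, h3, Pi.sub_apply, h4, h5, h6,
      slope_def_module]
  rw [hasDerivAt_iff_tendsto_slope, Lp.tendsto_Lp_iff_tendsto_eLpNorm']
  have hlim : Tendsto (fun t => ∫⁻ x, ‖slope (fun t => f t x) t₀ t - f' x‖ₑ ^ (2 : ℝ) ∂μ)
      (𝓝[≠] t₀) (𝓝 (∫⁻ _, 0 ∂μ)) := by
    refine tendsto_lintegral_filter_of_dominated_convergence'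
      (fun x => ‖2 * g x‖ₑ ^ (2 : ℝ)) ?_ ?_ ?_ ?_
    · refine Eventually.of_forall fun t => ?_
      have : AEStronglyMeasurable (fun x => slope (fun t => f t x) t₀ t - f' x) μ :=
        (Lp.aestronglyMeasurable _).congr (hFs t)
      exact this.enorm.pow_const _
    · filter_upwards [hsb] with t ht
      refine Eventually.of_forall fun x => ?_
      have h0 : 0 ≤ g x := (norm_nonneg _).trans (hf'b x)
      have : ‖slope (fun t => f t x) t₀ t - f' x‖ₑ ≤ ‖2 * g x‖ₑ := by
        rw [enorm_le_iff_norm_le, Real.norm_of_nonneg (by positivity)]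
        calc _ ≤ ‖slope (fun t => f t x) t₀ t‖ + ‖f' x‖ := norm_sub_le _ _
          _ ≤ g x + g x := add_le_add (ht x) (hf'b x)
          _ = _ := by ring
      gcongr
    · have h2 := (hg.const_mul 2).eLpNorm_lt_top
      rw [eLpNorm_lt_top_iff_lintegral_rpow_enorm_lt_top two_ne_zero ENNReal.ofNat_ne_top] at h2
      simpa using h2.ne
    · refine Eventually.of_forall fun x => ?_
      have h := ((hslope x).sub_const (f' x)).enorm
      rw [sub_self, enorm_zero] at h
      have h' := (ENNReal.continuous_rpow_const (y := (2 : ℝ))).tendsto 0 |>.comp h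
      simpa [Function.comp_def] using h'
  rw [lintegral_zero] at hlim
  have heq : ∀ t, eLpNorm (⇑(slope F t₀ t) - ⇑F') 2 μ =
      (∫⁻ x, ‖slope (fun t => f t x) t₀ t - f' x‖ₑ ^ (2 : ℝ) ∂μ) ^ (1 / 2 : ℝ) := by
    intro t
    rw [eLpNorm_congr_ae ((Lp.coeFn_sub _ _).symm.trans (hFs t)),
      eLpNorm_eq_lintegral_rpow_enorm_toReal two_ne_zero ENNReal.ofNat_ne_top]
    simp
  simp_rw [heq]
  have h' := (ENNReal.continuous_rpow_const (y := (1 / 2 : ℝ))).tendsto 0 |>.comp hlim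
  simpa [Function.comp_def] using h'

/-- Mean value inequality on a half-plane, which is convex and on which `|exp|` is at most `e^m`. -/
theorem norm_cexp_sub_cexp_le {u v : ℂ} {m : ℝ} (hu : u.re ≤ m) (hv : v.re ≤ m) :
    ‖Complex.exp u - Complex.exp v‖ ≤ Real.exp m * ‖u - v‖ := by
  refine Convex.norm_image_sub_le_of_norm_hasDerivWithin_le (𝕜 := ℂ) (f := Complex.exp)
    (f' := Complex.exp) (s := {w : ℂ | w.re ≤ m})
    (fun x _ => (Complex.hasDerivAt_exp x).hasDerivWithinAt) (fun x hx => ?_)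
    (convex_halfSpace_re_le m) hv hu
  rw [Complex.norm_exp]
  exact Real.exp_le_exp.2 hx

variable {V : Type*} [NormedAddCommGroup V] [InnerProductSpace ℝ V]
  [MeasurableSpace V] [BorelSpace V]

theorem memLp_one_add_sq_mul_exp (K C : ℝ) {c : ℝ} (hc : 0 < c) (ν : Measure V)
    [ν.HasTemperateGrowth] :
    MemLp (fun x : V => K * (1 + ‖x‖) ^ 2 * Real.exp (C - c * ‖x‖ ^ 2)) 2 ν := by
  -- Half of the Gaussian decay absorbs the polynomial weight; the other half is a Schwartz function
  -- and so lies in `L²`.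
  obtain ⟨L, hL0, hL⟩ := exists_one_add_pow_mul_exp_le 2 (half_pos hc)
  have hT : (fun x : V => -((c / 2 : ℝ) : ℂ) * ((‖x‖ ^ 2 : ℝ) : ℂ)).HasTemperateGrowth :=
    (Function.HasTemperateGrowth.const _).mul
      (Complex.ofRealCLM.hasTemperateGrowth.comp (Function.hasTemperateGrowth_norm_sq V))
  have hre : ∃ C c' : ℝ, 0 < c' ∧
      ∀ x : V, (-((c / 2 : ℝ) : ℂ) * ((‖x‖ ^ 2 : ℝ) : ℂ)).re ≤ C - c' * ‖x‖ ^ 2 := by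
    refine ⟨0, c / 2, half_pos hc, fun x => le_of_eq ?_⟩
    rw [← Complex.ofReal_neg, ← Complex.ofReal_mul, Complex.ofReal_re]
    ring
  have hS := (expSchwartz _ hT hre).memLp 2 ν
  refine hS.of_le_mul (c := |K| * Real.exp C * L) ?_ (Eventually.of_forall fun x => ?_)
  · exact (by fun_prop : Continuous fun x : V => K * (1 + ‖x‖) ^ 2 *
      Real.exp (C - c * ‖x‖ ^ 2)).aestronglyMeasurable
  · have h1 : 0 ≤ (1 + ‖x‖) ^ 2 := by positivity
    rw [expSchwartz_apply, Complex.norm_exp, ← Complex.ofReal_neg, ← Complex.ofReal_mul,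
      Complex.ofReal_re, norm_mul, norm_mul, Real.norm_eq_abs K, Real.norm_of_nonneg h1,
      Real.norm_of_nonneg (Real.exp_nonneg _)]
    have h2 : Real.exp (C - c * ‖x‖ ^ 2) = Real.exp C * Real.exp (-(c / 2 * ‖x‖ ^ 2)) *
        Real.exp (-(c / 2) * ‖x‖ ^ 2) := by
      rw [← Real.exp_add, ← Real.exp_add]
      congr 1
      ring
    rw [h2]
    calc _ = |K| * Real.exp C * ((1 + ‖x‖) ^ 2 * Real.exp (-(c / 2 * ‖x‖ ^ 2))) *
          Real.exp (-(c / 2) * ‖x‖ ^ 2) := by ring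
      _ ≤ _ := by gcongr; exact hL _ (norm_nonneg x)

/-- `L²` differentiability of a curve of Gaussians. -/
theorem hasDerivAt_Lp_exp {E : ℝ → V → ℂ} {E' : V → ℂ} {ν : Measure V} [ν.HasTemperateGrowth]
    {F : ℝ → Lp ℂ 2 ν} {F' : Lp ℂ 2 ν} {t₀ K C c : ℝ} (hc : 0 < c)
    (hF : ∀ t, F t =ᵐ[ν] fun x => Complex.exp (E t x))
    (hF' : F' =ᵐ[ν] fun x => Complex.exp (E t₀ x) * E' x)
    (hd : ∀ x, HasDerivAt (fun t => E t x) (E' x) t₀)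
    (hlip : ∀ᶠ t in 𝓝 t₀, ∀ x, ‖E t x - E t₀ x‖ ≤ |t - t₀| * (K * (1 + ‖x‖) ^ 2))
    (hre : ∀ᶠ t in 𝓝 t₀, ∀ x, (E t x).re ≤ C - c * ‖x‖ ^ 2) :
    HasDerivAt F F' t₀ := by
  refine hasDerivAt_Lp_of_dominated (memLp_one_add_sq_mul_exp K C hc ν) hF hF'
    (fun x => (hd x).cexp) ?_
  filter_upwards [hlip, hre] with t ht1 ht2 x
  refine (norm_cexp_sub_cexp_le (ht2 x) (hre.self_of_nhds x)).trans ?_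
  calc _ ≤ Real.exp (C - c * ‖x‖ ^ 2) * (|t - t₀| * (K * (1 + ‖x‖) ^ 2)) := by
        gcongr; exact ht1 x
    _ = _ := by ring

end Differentiation

/-! ### Polynomially bounded curves of functions -/

section PolynomialCurves

open Filter Topology

variable {V : Type*} [NormedAddCommGroup V]

/-- A curve of functions of growth at most `(1 + ‖x‖) ^ d` which is Lipschitz at `t₀` with
respect to the corresponding weighted sup norm. -/
def PolyLipschitzAt (d : ℕ) (P : ℝ → V → ℂ) (t₀ : ℝ) : Prop :=
  ∃ K : ℝ, 0 ≤ K ∧ ∀ᶠ t in 𝓝 t₀, ∀ x, ‖P t x‖ ≤ K * (1 + ‖x‖) ^ d ∧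
    ‖P t x - P t₀ x‖ ≤ |t - t₀| * (K * (1 + ‖x‖) ^ d)

variable {d e : ℕ} {P Q : ℝ → V → ℂ} {t₀ : ℝ}

theorem PolyLipschitzAt.mono (hP : PolyLipschitzAt d P t₀) (h : d ≤ e) :
    PolyLipschitzAt e P t₀ := by
  obtain ⟨K, hK, hP⟩ := hP
  refine ⟨K, hK, hP.mono fun t ht x => ?_⟩
  have h1 : (1 + ‖x‖) ^ d ≤ (1 + ‖x‖) ^ e :=
    pow_le_pow_right₀ (by linarith [norm_nonneg x]) h
  exact ⟨(ht x).1.trans (by gcongr), (ht x).2.trans (by gcongr)⟩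

theorem PolyLipschitzAt.add (hP : PolyLipschitzAt d P t₀) (hQ : PolyLipschitzAt d Q t₀) :
    PolyLipschitzAt d (fun t x => P t x + Q t x) t₀ := by
  obtain ⟨K, hK, hP⟩ := hP
  obtain ⟨L, hL, hQ⟩ := hQ
  refine ⟨K + L, by positivity, ?_⟩
  filter_upwards [hP, hQ] with t h1 h2 x
  constructor
  · calc _ ≤ ‖P t x‖ + ‖Q t x‖ := norm_add_le _ _
      _ ≤ _ := by linarith [(h1 x).1, (h2 x).1]
  · calc _ = ‖(P t x - P t₀ x) + (Q t x - Q t₀ x)‖ := by congr 1; ring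
      _ ≤ ‖P t x - P t₀ x‖ + ‖Q t x - Q t₀ x‖ := norm_add_le _ _
      _ ≤ _ := by linarith [(h1 x).2, (h2 x).2]

theorem PolyLipschitzAt.mul (hP : PolyLipschitzAt d P t₀) (hQ : PolyLipschitzAt e Q t₀) :
    PolyLipschitzAt (d + e) (fun t x => P t x * Q t x) t₀ := by
  obtain ⟨K, hK, hP⟩ := hP
  obtain ⟨L, hL, hQ⟩ := hQ
  have hQ₀ := hQ.self_of_nhds
  -- The factor `2` counts the two terms of the product rule in the Lipschitz bound.
  refine ⟨2 * (K * L), by positivity, ?_⟩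
  filter_upwards [hP, hQ] with t h1 h2 x
  have hx : 0 ≤ 1 + ‖x‖ := by positivity
  constructor
  · calc ‖P t x * Q t x‖ = ‖P t x‖ * ‖Q t x‖ := norm_mul _ _
      _ ≤ (K * (1 + ‖x‖) ^ d) * (L * (1 + ‖x‖) ^ e) := by
        gcongr
        exacts [(h1 x).1, (h2 x).1]
      _ = 1 * (K * L * (1 + ‖x‖) ^ (d + e)) := by rw [pow_add]; ring
      _ ≤ 2 * (K * L * (1 + ‖x‖) ^ (d + e)) := by gcongr; norm_num
      _ = _ := by ring
  · calc _ = ‖P t x * (Q t x - Q t₀ x) + (P t x - P t₀ x) * Q t₀ x‖ := by congr 1; ring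
      _ ≤ ‖P t x‖ * ‖Q t x - Q t₀ x‖ + ‖P t x - P t₀ x‖ * ‖Q t₀ x‖ := by
        rw [← norm_mul, ← norm_mul]; exact norm_add_le _ _
      _ ≤ (K * (1 + ‖x‖) ^ d) * (|t - t₀| * (L * (1 + ‖x‖) ^ e)) +
          (|t - t₀| * (K * (1 + ‖x‖) ^ d)) * (L * (1 + ‖x‖) ^ e) := by
        gcongr
        exacts [(h1 x).1, (h2 x).2, (h1 x).2, (hQ₀ x).1]
      _ = _ := by rw [pow_add]; ring

theorem polyLipschitzAt_of_hasDerivAt {a : ℝ → ℂ} {a' : ℂ} (ha : HasDerivAt a a' t₀) :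
    PolyLipschitzAt 0 (fun t (_ : V) => a t) t₀ := by
  obtain ⟨K, hK0, hK⟩ := ha.isBigO_sub.exists_nonneg
  refine ⟨K + (‖a t₀‖ + 1), by positivity, ?_⟩
  have hc : ∀ᶠ t in 𝓝 t₀, ‖a t‖ < ‖a t₀‖ + 1 :=
    ha.continuousAt.norm.eventually_lt continuousAt_const (lt_add_one _)
  filter_upwards [hK.bound, hc] with t h1 h2 x
  rw [Real.norm_eq_abs] at h1
  simp only [pow_zero, mul_one]
  refine ⟨by linarith, h1.trans ?_⟩
  rw [mul_comm]
  gcongr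
  linarith [norm_nonneg (a t₀)]

theorem polyLipschitzAt_const (a : ℂ) : PolyLipschitzAt 0 (fun _ (_ : V) => a) t₀ :=
  polyLipschitzAt_of_hasDerivAt (hasDerivAt_const t₀ a)

theorem polyLipschitzAt_fun {f : V → ℂ} (hf : ∀ x, ‖f x‖ ≤ (1 + ‖x‖) ^ d) :
    PolyLipschitzAt d (fun _ x => f x) t₀ := by
  refine ⟨1, zero_le_one, Eventually.of_forall fun t x => ⟨by simpa using hf x, ?_⟩⟩
  simp only [sub_self, norm_zero]
  positivity

theorem PolyLipschitzAt.sum {ι : Type*} (s : Finset ι) {P : ι → ℝ → V → ℂ}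
    (hP : ∀ i ∈ s, PolyLipschitzAt d (P i) t₀) :
    PolyLipschitzAt d (fun t x => ∑ i ∈ s, P i t x) t₀ := by
  classical
  induction s using Finset.induction_on with
  | empty => simpa using (polyLipschitzAt_const (V := V) (t₀ := t₀) 0).mono (Nat.zero_le d)
  | insert i s hi ih =>
    simp only [Finset.sum_insert hi]
    exact (hP i (Finset.mem_insert_self i s)).add
      (ih fun j hj => hP j (Finset.mem_insert_of_mem hj))

end PolynomialCurves

/-! ### Gaussian waves with complex amplitude -/

section GaussianWave

/-- The exponent of the Gaussian wave `e^c e^{(i/ħ)(p₀·x - ½p₀·x₀)} e^{-(X+iY)(x-x₀)·(x-x₀)/2ħ}`. -/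
def gaussianExponent (ħ : ℝ) (X Y : Matrix (Fin n) (Fin n) ℝ) (z₀ : PhaseSpace n) (c : ℂ)
    (x : ConfigSpace n) : ℂ :=
  c + (Complex.I / ħ * ((inner ℝ (momentum z₀) x -
      (1 / 2) * inner ℝ (momentum z₀) (position z₀) : ℝ) : ℂ) +
    -(1 / (2 * (ħ : ℂ))) * ((quadForm X (x - position z₀) : ℂ) +
      Complex.I * (quadForm Y (x - position z₀) : ℂ)))

theorem hasTemperateGrowth_quadForm (A : Matrix (Fin n) (Fin n) ℝ) :
    (fun x : ConfigSpace n => ((quadForm A x : ℝ) : ℂ)).HasTemperateGrowth := by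
  have h : quadForm A = fun x : ConfigSpace n =>
      inner ℝ ((Matrix.toEuclideanLin A).toContinuousLinearMap x) x := by
    funext x
    rw [quadForm_eq_inner]
    rfl
  have hq : (quadForm A : ConfigSpace n → ℝ).HasTemperateGrowth := by
    rw [h]
    exact ContinuousLinearMap.bilinear_hasTemperateGrowth (𝕜 := ℝ) (innerSL ℝ)
      (ContinuousLinearMap.hasTemperateGrowth _) Function.HasTemperateGrowth.id
  exact Complex.ofRealCLM.hasTemperateGrowth.comp hq

theorem hasTemperateGrowth_gaussianExponent (ħ : ℝ) (X Y : Matrix (Fin n) (Fin n) ℝ)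
    (z₀ : PhaseSpace n) (c : ℂ) : (gaussianExponent ħ X Y z₀ c).HasTemperateGrowth := by
  have hs : (fun x : ConfigSpace n => x - position z₀).HasTemperateGrowth :=
    Function.HasTemperateGrowth.id.sub (.const _)
  refine .add (.const _) (.add (.mul (.const _) ?_) (.mul (.const _) (.add ?_
    (.mul (.const _) ?_))))
  · exact Complex.ofRealCLM.hasTemperateGrowth.comp
      ((Function.hasTemperateGrowth_inner_right (momentum z₀)).sub (.const _))
  · exact (hasTemperateGrowth_quadForm X).comp hs
  · exact (hasTemperateGrowth_quadForm Y).comp hs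

theorem gaussianExponent_re (ħ : ℝ) (X Y : Matrix (Fin n) (Fin n) ℝ)
    (z₀ : PhaseSpace n) (c : ℂ) (x : ConfigSpace n) :
    (gaussianExponent ħ X Y z₀ c x).re =
      c.re - 1 / (2 * ħ) * quadForm X (x - position z₀) := by
  have h1 : -(1 / (2 * (ħ : ℂ))) = ((-(1 / (2 * ħ)) : ℝ) : ℂ) := by push_cast; rfl
  have h2 : ∀ r : ℝ, Complex.I / ħ * (r : ℂ) = Complex.I * ((r / ħ : ℝ) : ℂ) := by
    intro r; push_cast; ring
  rw [gaussianExponent, h1, h2, Complex.add_re, Complex.add_re, Complex.re_ofReal_mul,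
    Complex.add_re, Complex.re_mul_ofReal, Complex.re_mul_ofReal]
  simp
  ring

/-- Expand `0 ≤ A(v - w/L)·(v - w/L)` with `w = A⁻¹ v`: the cross term is `-2‖v‖²/L`, and the last
term is at most `‖v‖²/L`. Thus coercivity of `X` follows from an upper bound on `X⁻¹`, which the
entries of `X⁻¹` supply uniformly for nearby times. -/
theorem le_quadForm_of_inv_le {A : Matrix (Fin n) (Fin n) ℝ} (hA : A.PosDef) {L : ℝ} (hL : 0 < L)
    (h : ∀ v : ConfigSpace n, quadForm A⁻¹ v ≤ L * ‖v‖ ^ 2) (v : ConfigSpace n) :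
    1 / L * ‖v‖ ^ 2 ≤ quadForm A v := by
  have hu := isUnit_det_of_posDef hA
  set w := Matrix.toEuclideanLin A⁻¹ v
  have hw : Matrix.toEuclideanLin A w = v := by
    rw [← toEuclideanLin_mul_apply, Matrix.mul_nonsing_inv _ hu, toEuclideanLin_one_apply]
  have h0 := quadForm_nonneg hA ((-(1 / L)) • w + v)
  have hqw : quadForm A w = quadForm A⁻¹ v := by
    rw [quadForm_eq_inner, hw, quadForm_eq_inner, real_inner_comm]
  rw [quadForm_add A (isSymm_of_posDef hA), quadForm_smul, map_smul, hw, real_inner_smul_left,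
    real_inner_self_eq_norm_sq, hqw] at h0
  have h1 := h v
  have h2 : (-(1 / L)) ^ 2 * quadForm A⁻¹ v ≤ 1 / L * ‖v‖ ^ 2 := by
    calc _ ≤ (-(1 / L)) ^ 2 * (L * ‖v‖ ^ 2) := by gcongr
      _ = _ := by field_simp
  linarith

/-- The constants depend on the wave only through `L` and `B`, so one Gaussian majorant serves all
times near a given one. -/
theorem gaussianExponent_re_le {ħ : ℝ} (hħ : 0 < ħ) {X : Matrix (Fin n) (Fin n) ℝ}
    (hX : X.PosDef) (Y : Matrix (Fin n) (Fin n) ℝ) {L B : ℝ} (hL : 0 < L)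
    (h : ∀ v : ConfigSpace n, quadForm X⁻¹ v ≤ L * ‖v‖ ^ 2)
    {z₀ : PhaseSpace n} {c : ℂ} (hz : ‖position z₀‖ ≤ B) (hc : c.re ≤ B) (x : ConfigSpace n) :
    (gaussianExponent ħ X Y z₀ c x).re ≤
      (B + 1 / (2 * ħ * L) * B ^ 2) - 1 / (4 * ħ * L) * ‖x‖ ^ 2 := by
  rw [gaussianExponent_re]
  have h1 := le_quadForm_of_inv_le hX hL h (x - position z₀)
  have h2 : ‖x‖ ^ 2 ≤ 2 * ‖x - position z₀‖ ^ 2 + 2 * B ^ 2 := by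
    have h3 : ‖x‖ ≤ ‖x - position z₀‖ + B := by
      calc ‖x‖ = ‖(x - position z₀) + position z₀‖ := by rw [sub_add_cancel]
        _ ≤ _ := (norm_add_le _ _).trans (by gcongr)
    calc ‖x‖ ^ 2 ≤ (‖x - position z₀‖ + B) ^ 2 := by gcongr
      _ ≤ _ := by nlinarith [sq_nonneg (‖x - position z₀‖ - B)]
  have h4 : 1 / (2 * ħ) * (1 / L * ‖x - position z₀‖ ^ 2) ≤
      1 / (2 * ħ) * quadForm X (x - position z₀) := by gcongr
  have h5 : 1 / (4 * ħ * L) * ‖x‖ ^ 2 ≤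
      1 / (4 * ħ * L) * (2 * ‖x - position z₀‖ ^ 2 + 2 * B ^ 2) := by gcongr
  have h6 : 1 / (4 * ħ * L) * (2 * ‖x - position z₀‖ ^ 2 + 2 * B ^ 2) =
      1 / (2 * ħ) * (1 / L * ‖x - position z₀‖ ^ 2) + 1 / (2 * ħ * L) * B ^ 2 := by
    field_simp
    ring
  linarith

theorem quadForm_le_sum_abs (A : Matrix (Fin n) (Fin n) ℝ) (v : ConfigSpace n) :
    quadForm A v ≤ (∑ i, ∑ j, |A i j|) * ‖v‖ ^ 2 := by
  have : quadForm A v = ∑ i, ∑ j, A i j * v j * v i := by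
    simp [quadForm, dotProduct, Matrix.mulVec, Finset.sum_mul]
  rw [this, Finset.sum_mul]
  refine Finset.sum_le_sum fun i _ => ?_
  rw [Finset.sum_mul]
  refine Finset.sum_le_sum fun j _ => ?_
  refine (le_abs_self _).trans ?_
  rw [abs_mul, abs_mul, mul_assoc, sq]
  gcongr <;> exact PiLp.norm_apply_le v _

theorem exists_gaussianExponent_re_le {ħ : ℝ} (hħ : 0 < ħ) {X : Matrix (Fin n) (Fin n) ℝ}
    (hX : X.PosDef) (Y : Matrix (Fin n) (Fin n) ℝ) (z₀ : PhaseSpace n) (c : ℂ) :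
    ∃ C κ : ℝ, 0 < κ ∧ ∀ x, (gaussianExponent ħ X Y z₀ c x).re ≤ C - κ * ‖x‖ ^ 2 := by
  set L := (∑ i, ∑ j, |X⁻¹ i j|) + 1
  have hL : 0 < L := by positivity
  refine ⟨_, 1 / (4 * ħ * L), by positivity, gaussianExponent_re_le hħ hX Y hL (fun v => ?_)
    (le_max_left ‖position z₀‖ c.re) (le_max_right _ _)⟩
  exact (quadForm_le_sum_abs _ v).trans (by gcongr; simp [L])

/-- The Gaussian wave with exponent `gaussianExponent` as a Schwartz function. -/
def gaussianWave {ħ : ℝ} (hħ : 0 < ħ) {X : Matrix (Fin n) (Fin n) ℝ}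
    (hX : X.PosDef) (Y : Matrix (Fin n) (Fin n) ℝ) (z₀ : PhaseSpace n) (c : ℂ) :
    𝓢(ConfigSpace n, ℂ) :=
  expSchwartz (gaussianExponent ħ X Y z₀ c) (hasTemperateGrowth_gaussianExponent ħ X Y z₀ c)
    (exists_gaussianExponent_re_le hħ hX Y z₀ c)

theorem gaussianWave_apply {ħ : ℝ} (hħ : 0 < ħ) {X : Matrix (Fin n) (Fin n) ℝ}
    (hX : X.PosDef) (Y : Matrix (Fin n) (Fin n) ℝ) (z₀ : PhaseSpace n) (c : ℂ)
    (x : ConfigSpace n) :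
    gaussianWave hħ hX Y z₀ c x = Complex.exp (gaussianExponent ħ X Y z₀ c x) := rfl

theorem coherentState_eq {ħ : ℝ} (hħ : 0 < ħ) {X : Matrix (Fin n) (Fin n) ℝ}
    (hX : X.PosDef) (Y : Matrix (Fin n) (Fin n) ℝ) (z₀ : PhaseSpace n) (γ : ℝ) {c : ℂ}
    (hc : c = ((Real.log ((Real.pi * ħ) ^ (-(n : ℝ) / 4) * X.det ^ (1 / 4 : ℝ)) : ℝ) : ℂ) +
      Complex.I / ħ * γ) :
    coherentState ħ X Y z₀ γ = gaussianWave hħ hX Y z₀ c := by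
  funext x
  have hd : 0 < X.det := hX.det_pos
  have ha : 0 < (Real.pi * ħ) ^ (-(n : ℝ) / 4) * X.det ^ (1 / 4 : ℝ) := by positivity
  rw [gaussianWave_apply, gaussianExponent, Complex.exp_add, Complex.exp_add, hc, Complex.exp_add,
    ← Complex.ofReal_exp, Real.exp_log ha, coherentState, heisenbergWeyl, squeezedGaussian]
  ring

end GaussianWave

/-! ### The Weyl Hamiltonian acting on a Gaussian -/

section WeylAction

/-- The point `(x, p)` of phase space. -/
def joinPhase (x p : ConfigSpace n) : PhaseSpace n := WithLp.toLp 2 (Sum.elim x.ofLp p.ofLp)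

theorem joinPhase_inl (x p : ConfigSpace n) (j : Fin n) : joinPhase x p (Sum.inl j) = x j := rfl

theorem joinPhase_inr (x p : ConfigSpace n) (j : Fin n) : joinPhase x p (Sum.inr j) = p j := rfl

/-- The complex phase space coordinates `(x, -iħ∇E(x))`, where `E` is the exponent of a Gaussian
wave centred at `z₀`. -/
def complexPoint (X Y : Matrix (Fin n) (Fin n) ℝ) (z₀ : PhaseSpace n) (x : ConfigSpace n)
    (α : Fin n ⊕ Fin n) : ℂ :=
  ((z₀ + joinPhase (x - position z₀) (-Matrix.toEuclideanLin Y (x - position z₀))) α : ℂ) +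
    Complex.I * (joinPhase 0 (Matrix.toEuclideanLin X (x - position z₀)) α : ℂ)

/-- The differential of `complexPoint`. -/
def complexTangent (X Y : Matrix (Fin n) (Fin n) ℝ) (v : ConfigSpace n)
    (α : Fin n ⊕ Fin n) : ℂ :=
  (joinPhase v (-Matrix.toEuclideanLin Y v) α : ℂ) +
    Complex.I * (joinPhase 0 (Matrix.toEuclideanLin X v) α : ℂ)

theorem complexPoint_add_smul (X Y : Matrix (Fin n) (Fin n) ℝ) (z₀ : PhaseSpace n)
    (x v : ConfigSpace n) (t : ℝ) (α : Fin n ⊕ Fin n) :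
    complexPoint X Y z₀ (x + t • v) α = complexPoint X Y z₀ x α + t * complexTangent X Y v α := by
  have h : x + t • v - position z₀ = (x - position z₀) + t • v := by abel
  unfold complexPoint complexTangent
  rw [h]
  rcases α with j | j
  · simp only [PiLp.add_apply, joinPhase_inl, PiLp.smul_apply, smul_eq_mul, PiLp.zero_apply]
    push_cast
    ring
  · simp only [PiLp.add_apply, joinPhase_inr, map_add, map_smul, PiLp.neg_apply, PiLp.smul_apply,
      smul_eq_mul]
    push_cast
    ring

theorem complexPoint_inl (X Y : Matrix (Fin n) (Fin n) ℝ) (z₀ : PhaseSpace n)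
    (x : ConfigSpace n) (j : Fin n) : complexPoint X Y z₀ x (Sum.inl j) = (x j : ℂ) := by
  simp [complexPoint, joinPhase_inl, position]

theorem complexPoint_inr (X Y : Matrix (Fin n) (Fin n) ℝ) (z₀ : PhaseSpace n)
    (x : ConfigSpace n) (j : Fin n) : complexPoint X Y z₀ x (Sum.inr j) =
      (momentum z₀ j : ℂ) - (Matrix.toEuclideanLin Y (x - position z₀) j : ℂ) +
        Complex.I * (Matrix.toEuclideanLin X (x - position z₀) j : ℂ) := by
  simp only [complexPoint, joinPhase_inr, PiLp.add_apply, PiLp.neg_apply, momentum]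
  push_cast
  ring

/-- Taylor expansion of a quadratic polynomial along a line; the coefficient of `t` is the
directional derivative, from which `p̂` is computed. -/
theorem gaussianExponent_add_smul (ħ : ℝ) {X Y : Matrix (Fin n) (Fin n) ℝ} (hX : X.IsSymm)
    (hY : Y.IsSymm) (z₀ : PhaseSpace n) (c : ℂ) (x v : ConfigSpace n) (t : ℝ) :
    gaussianExponent ħ X Y z₀ c (x + t • v) = gaussianExponent ħ X Y z₀ c x +
      t * (Complex.I / ħ * (inner ℝ (momentum z₀) v : ℝ) -
        1 / ħ * ((inner ℝ (Matrix.toEuclideanLin X (x - position z₀)) v : ℝ) +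
          Complex.I * (inner ℝ (Matrix.toEuclideanLin Y (x - position z₀)) v : ℝ))) +
      t ^ 2 * (-(1 / (2 * (ħ : ℂ))) * ((quadForm X v : ℝ) + Complex.I * (quadForm Y v : ℝ))) := by
  have h : x + t • v - position z₀ = (x - position z₀) + t • v := by abel
  simp only [gaussianExponent, h, quadForm_add X hX, quadForm_add Y hY, quadForm_smul,
    real_inner_smul_right, inner_add_right]
  push_cast
  ring

theorem lineDeriv_gaussian {V : Type*} [NormedAddCommGroup V] [NormedSpace ℝ V] {f : V → ℂ}
    {x v : V} {w e E a b : ℂ}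
    (h : ∀ t : ℝ, f (x + t • v) = (w + t * e) * Complex.exp (E + t * a + t ^ 2 * b)) :
    lineDeriv ℝ f x v = (e + w * a) * Complex.exp E := by
  have h0 : HasDerivAt (fun t : ℝ => (t : ℂ)) 1 0 := Complex.ofRealCLM.hasDerivAt
  have h1 := ((h0.mul_const e).const_add w).mul
    (((h0.mul_const a).const_add E).add ((h0.pow 2).mul_const b)).cexp
  have h2 : (fun t : ℝ => f (x + t • v)) =
      fun t : ℝ => (w + t * e) * Complex.exp (E + t * a + t ^ 2 * b) := funext h
  rw [lineDeriv, h2]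
  refine h1.deriv.trans ?_
  simp
  ring

variable {ħ : ℝ} (hħ : 0 < ħ) {X Y : Matrix (Fin n) (Fin n) ℝ}

/-- The factor `w` is affine along `e_j` with slope `e`. The case `w = 1` gives one application of
`p̂_j`; a coordinate of `complexPoint` as `w` gives the second. -/
theorem quantizedCoord_inr_gaussian (hX : X.PosDef) (hY : Y.IsSymm) (z₀ : PhaseSpace n) (c : ℂ)
    {φ : 𝓢(ConfigSpace n, ℂ)} {w : ConfigSpace n → ℂ} {e : ℂ} {j : Fin n}
    (hφ : ∀ x, φ x = w x * gaussianWave hħ hX Y z₀ c x) (x : ConfigSpace n)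
    (hw : ∀ t : ℝ, w (x + t • EuclideanSpace.single j (1 : ℝ)) = w x + t * e) :
    quantizedCoord ħ (Sum.inr j) φ x =
      (-(Complex.I * ħ) * e + complexPoint X Y z₀ x (Sum.inr j) * w x) *
        gaussianWave hħ hX Y z₀ c x := by
  have hħ' : (ħ : ℂ) ≠ 0 := by exact_mod_cast hħ.ne'
  have hs : ∀ u : ConfigSpace n, inner ℝ u (EuclideanSpace.single j (1 : ℝ)) = u j := by
    intro u; simp [EuclideanSpace.inner_single_right]
  rw [quantizedCoord_inr_apply, lineDeriv_gaussian (fun t => by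
    rw [hφ, hw, gaussianWave_apply, gaussianExponent_add_smul ħ (isSymm_of_posDef hX) hY]),
    gaussianWave_apply, complexPoint_inr, hs, hs, hs]
  have h1 : (ħ : ℂ) * (Complex.I / ħ) = Complex.I := by field_simp
  have h2 : (ħ : ℂ) * (1 / ħ) = 1 := by field_simp
  have h3 := Complex.I_mul_I
  set p : ℂ := (momentum z₀ j : ℂ)
  set s : ℂ := ((Matrix.toEuclideanLin X (x - position z₀) j : ℝ) : ℂ)
  set r : ℂ := ((Matrix.toEuclideanLin Y (x - position z₀) j : ℝ) : ℂ)
  set g := Complex.exp (gaussianExponent ħ X Y z₀ c x)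
  linear_combination (-Complex.I * w x * g * p) * h1 + (Complex.I * w x * g * (s + Complex.I * r)) *
    h2 + (w x * g * (r - p)) * h3

/-- The correction to the product of symbols in `ẑ_β ẑ_α`. -/
def orderingTerm (ħ : ℝ) (X Y : Matrix (Fin n) (Fin n) ℝ) :
    Fin n ⊕ Fin n → Fin n ⊕ Fin n → ℂ
  | Sum.inl _, _ => 0
  | Sum.inr j, α => -(Complex.I * ħ) * complexTangent X Y (EuclideanSpace.single j (1 : ℝ)) α

theorem quantizedCoord_gaussian (hX : X.PosDef) (hY : Y.IsSymm) (z₀ : PhaseSpace n) (c : ℂ)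
    (α : Fin n ⊕ Fin n) (x : ConfigSpace n) :
    quantizedCoord ħ α (gaussianWave hħ hX Y z₀ c) x =
      complexPoint X Y z₀ x α * gaussianWave hħ hX Y z₀ c x := by
  rcases α with j | j
  · rw [quantizedCoord_inl_apply, complexPoint_inl]
  · rw [quantizedCoord_inr_gaussian hħ hX hY z₀ c (w := fun _ => 1) (e := 0)
      (fun x => (one_mul _).symm) x (fun t => by ring)]
    ring

/-- The first operator leaves an affine function times the Gaussian. If the second is a momentum, it
also differentiates that affine factor, which adds a term independent of `x`. -/
theorem quantizedCoord_quantizedCoord_gaussian (hX : X.PosDef) (hY : Y.IsSymm)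
    (z₀ : PhaseSpace n) (c : ℂ) (α β : Fin n ⊕ Fin n) (x : ConfigSpace n) :
    quantizedCoord ħ β (quantizedCoord ħ α (gaussianWave hħ hX Y z₀ c)) x =
      (orderingTerm ħ X Y β α + complexPoint X Y z₀ x β * complexPoint X Y z₀ x α) *
        gaussianWave hħ hX Y z₀ c x := by
  rcases β with j | j
  · rw [quantizedCoord_inl_apply, quantizedCoord_gaussian hħ hX hY, complexPoint_inl, orderingTerm]
    ring
  · rw [quantizedCoord_inr_gaussian hħ hX hY z₀ c (quantizedCoord_gaussian hħ hX hY z₀ c α) x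
      (fun t => complexPoint_add_smul X Y z₀ x _ t α), orderingTerm]

theorem weylHamiltonian_apply (R : Matrix (Fin n ⊕ Fin n) (Fin n ⊕ Fin n) ℝ)
    (φ : 𝓢(ConfigSpace n, ℂ)) (x : ConfigSpace n) :
    weylHamiltonian ħ R φ x = (1 / 2) * ∑ α, ∑ β, (R α β : ℂ) * ((1 / 2) *
      (quantizedCoord ħ α (quantizedCoord ħ β φ) x +
        quantizedCoord ħ β (quantizedCoord ħ α φ) x)) := by
  simp only [weylHamiltonian, smul_apply, sum_apply, add_apply, ContinuousLinearMap.comp_apply,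
    smul_eq_mul]

theorem weylHamiltonian_gaussian (R : Matrix (Fin n ⊕ Fin n) (Fin n ⊕ Fin n) ℝ) (hX : X.PosDef)
    (hY : Y.IsSymm) (z₀ : PhaseSpace n) (c : ℂ) (x : ConfigSpace n) :
    weylHamiltonian ħ R (gaussianWave hħ hX Y z₀ c) x =
      ((1 / 2) * ∑ α, ∑ β, (R α β : ℂ) * (complexPoint X Y z₀ x α * complexPoint X Y z₀ x β) +
        (1 / 2) * ∑ α, ∑ β, (R α β : ℂ) *
          ((1 / 2) * (orderingTerm ħ X Y α β + orderingTerm ħ X Y β α))) *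
        gaussianWave hħ hX Y z₀ c x := by
  rw [weylHamiltonian_apply, ← mul_add, mul_assoc, ← Finset.sum_add_distrib, Finset.sum_mul]
  congr 1
  refine Finset.sum_congr rfl fun α _ => ?_
  rw [← Finset.sum_add_distrib, Finset.sum_mul]
  refine Finset.sum_congr rfl fun β _ => ?_
  rw [quantizedCoord_quantizedCoord_gaussian hħ hX hY, quantizedCoord_quantizedCoord_gaussian hħ hX hY]
  ring

theorem complexTangent_single_inl (j k : Fin n) :
    complexTangent X Y (EuclideanSpace.single j (1 : ℝ)) (Sum.inl k) = if k = j then 1 else 0 := by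
  by_cases h : k = j <;> simp [complexTangent, joinPhase_inl, h]

theorem complexTangent_single_inr (j k : Fin n) :
    complexTangent X Y (EuclideanSpace.single j (1 : ℝ)) (Sum.inr k) =
      -(Y k j : ℂ) + Complex.I * (X k j : ℂ) := by
  simp [complexTangent, joinPhase_inr]

/-- This is `iħ` times the rate of change of `c`. The mixed terms `x̂_j p̂_k` contribute the trace
of `R₁₂`, the terms `p̂_j p̂_k` those of `R₂₂ X` and `R₂₂ Y`. -/
theorem sum_orderingTerm {R : Matrix (Fin n ⊕ Fin n) (Fin n ⊕ Fin n) ℝ} (hR : R.IsSymm)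
    (hX : X.IsSymm) (hY : Y.IsSymm) :
    (1 / 2) * ∑ α, ∑ β, (R α β : ℂ) *
      ((1 / 2) * (orderingTerm ħ X Y α β + orderingTerm ħ X Y β α)) =
    Complex.I * ħ * (-(1 / 2) * ((R.toBlocks₁₂.trace : ℝ) +
      Complex.I * (((R.toBlocks₂₂ * X).trace : ℝ) +
        Complex.I * ((R.toBlocks₂₂ * Y).trace : ℝ)))) := by
  have h21 : ∀ j k, R (Sum.inr j) (Sum.inl k) = R (Sum.inl k) (Sum.inr j) :=
    fun j k => hR.apply _ _
  have hXs : ∀ j k, X j k = X k j := fun j k => hX.apply _ _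
  have hYs : ∀ j k, Y j k = Y k j := fun j k => hY.apply _ _
  have e1 : ((R.toBlocks₁₂.trace : ℝ) : ℂ) = ∑ k, (R (Sum.inl k) (Sum.inr k) : ℂ) := by
    simp [Matrix.trace, Matrix.toBlocks₁₂]
  have e2 : ∀ Z : Matrix (Fin n) (Fin n) ℝ, (((R.toBlocks₂₂ * Z).trace : ℝ) : ℂ) =
      ∑ j, ∑ k, (R (Sum.inr j) (Sum.inr k) : ℂ) * (Z k j : ℂ) := by
    intro Z; simp [Matrix.trace, Matrix.mul_apply, Matrix.toBlocks₂₂]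
  have f1 : ∀ j k : Fin n, orderingTerm ħ X Y (Sum.inl j) (Sum.inr k) +
      orderingTerm ħ X Y (Sum.inr k) (Sum.inl j) = if k = j then -(Complex.I * ħ) else 0 := by
    intro j k
    simp only [orderingTerm, complexTangent_single_inl, zero_add, mul_ite, mul_one, mul_zero,
      eq_comm]
  have f2 : ∀ j k : Fin n, (1 / 2) * (orderingTerm ħ X Y (Sum.inr j) (Sum.inr k) +
      orderingTerm ħ X Y (Sum.inr k) (Sum.inr j)) =
        -(Complex.I * ħ) * (-(Y k j : ℂ) + Complex.I * (X k j : ℂ)) := by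
    intro j k
    simp only [orderingTerm, complexTangent_single_inr, hXs j k, hYs j k]
    ring
  have s11 : ∑ j : Fin n, ∑ k : Fin n, (R (Sum.inl j) (Sum.inl k) : ℂ) *
      ((1 / 2) * (orderingTerm ħ X Y (Sum.inl j) (Sum.inl k) +
        orderingTerm ħ X Y (Sum.inl k) (Sum.inl j))) = 0 := by
    simp [orderingTerm]
  have s12 : ∑ j : Fin n, ∑ k : Fin n, (R (Sum.inl j) (Sum.inr k) : ℂ) *
      ((1 / 2) * (orderingTerm ħ X Y (Sum.inl j) (Sum.inr k) +
        orderingTerm ħ X Y (Sum.inr k) (Sum.inl j))) =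
      ∑ j, (R (Sum.inl j) (Sum.inr j) : ℂ) * ((1 / 2) * -(Complex.I * ħ)) := by
    refine Finset.sum_congr rfl fun j _ => ?_
    simp [f1]
  have s21 : ∑ j : Fin n, ∑ k : Fin n, (R (Sum.inr j) (Sum.inl k) : ℂ) *
      ((1 / 2) * (orderingTerm ħ X Y (Sum.inr j) (Sum.inl k) +
        orderingTerm ħ X Y (Sum.inl k) (Sum.inr j))) =
      ∑ j, (R (Sum.inl j) (Sum.inr j) : ℂ) * ((1 / 2) * -(Complex.I * ħ)) := by
    refine Finset.sum_congr rfl fun j _ => ?_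
    simp [add_comm (orderingTerm ħ X Y (Sum.inr j) _), f1, h21]
  have s22 : ∑ j : Fin n, ∑ k : Fin n, (R (Sum.inr j) (Sum.inr k) : ℂ) *
      ((1 / 2) * (orderingTerm ħ X Y (Sum.inr j) (Sum.inr k) +
        orderingTerm ħ X Y (Sum.inr k) (Sum.inr j))) =
      -(Complex.I * ħ) * (-(∑ j, ∑ k, (R (Sum.inr j) (Sum.inr k) : ℂ) * (Y k j : ℂ)) +
        Complex.I * ∑ j, ∑ k, (R (Sum.inr j) (Sum.inr k) : ℂ) * (X k j : ℂ)) := by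
    simp only [f2, Finset.mul_sum, ← Finset.sum_neg_distrib, ← Finset.sum_add_distrib]
    refine Finset.sum_congr rfl fun j _ => Finset.sum_congr rfl fun k _ => ?_
    ring
  simp only [Fintype.sum_sum_type, Finset.sum_add_distrib]
  rw [s11, s12, s21, s22, e1, e2, e2, ← Finset.sum_mul]
  linear_combination (-(1 / 2) * Complex.I * ħ * ∑ j, ∑ k, (R (Sum.inr j) (Sum.inr k) : ℂ) *
    (Y k j : ℂ)) * (-Complex.I_sq)

end WeylAction

/-! ### The Hamiltonian symbol along a Gaussian -/

section EnergyIdentity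

theorem toEuclideanLin_joinPhase (R : Matrix (Fin n ⊕ Fin n) (Fin n ⊕ Fin n) ℝ)
    (v w : ConfigSpace n) :
    Matrix.toEuclideanLin R (joinPhase v w) =
      joinPhase (Matrix.toEuclideanLin R.toBlocks₁₁ v + Matrix.toEuclideanLin R.toBlocks₁₂ w)
        (Matrix.toEuclideanLin R.toBlocks₂₁ v + Matrix.toEuclideanLin R.toBlocks₂₂ w) := by
  apply WithLp.ofLp_injective
  have h := Matrix.fromBlocks_mulVec R.toBlocks₁₁ R.toBlocks₁₂ R.toBlocks₂₁ R.toBlocks₂₂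
    (Sum.elim v.ofLp w.ofLp)
  rw [Matrix.fromBlocks_toBlocks] at h
  simp only [joinPhase, Matrix.ofLp_toLpLin, Matrix.toLin'_apply, h, WithLp.ofLp_add]
  rfl

theorem inner_joinPhase (u : PhaseSpace n) (v w : ConfigSpace n) :
    inner ℝ u (joinPhase v w) = inner ℝ (position u) v + inner ℝ (momentum u) w :=
  inner_position_momentum u (joinPhase v w)

theorem toBlocks₂₁_eq {R : Matrix (Fin n ⊕ Fin n) (Fin n ⊕ Fin n) ℝ} (hR : R.IsSymm) :
    R.toBlocks₂₁ = R.toBlocks₁₂ᵀ := by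
  ext i j
  exact (hR.apply _ _).symm

theorem toBlocks₂₂_isSymm {R : Matrix (Fin n ⊕ Fin n) (Fin n ⊕ Fin n) ℝ} (hR : R.IsSymm) :
    R.toBlocks₂₂.IsSymm := by
  ext i j
  exact hR.apply _ _

theorem quadForm_joinPhase {R : Matrix (Fin n ⊕ Fin n) (Fin n ⊕ Fin n) ℝ} (hR : R.IsSymm)
    (v w : ConfigSpace n) :
    quadForm R (joinPhase v w) = quadForm R.toBlocks₁₁ v +
      2 * inner ℝ (Matrix.toEuclideanLin R.toBlocks₁₂ᵀ v) w + quadForm R.toBlocks₂₂ w := by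
  rw [quadForm_eq_inner, toEuclideanLin_joinPhase, inner_joinPhase, toBlocks₂₁_eq hR]
  change inner ℝ (_ + _) v + inner ℝ (_ + _) w = _
  rw [inner_add_left, inner_add_left, quadForm_eq_inner, quadForm_eq_inner,
    inner_toEuclideanLin_left R.toBlocks₁₂ w v, real_inner_comm w]
  ring

theorem position_standardJ (R : Matrix (Fin n ⊕ Fin n) (Fin n ⊕ Fin n) ℝ) (z : PhaseSpace n) :
    position (Matrix.toEuclideanLin (standardJ n * R) z) =
      momentum (Matrix.toEuclideanLin R z) := by
  rw [toEuclideanLin_mul_apply]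
  set w := Matrix.toEuclideanLin R z
  ext j
  have h := Matrix.fromBlocks_mulVec (0 : Matrix (Fin n) (Fin n) ℝ)
    (1 : Matrix (Fin n) (Fin n) ℝ) (-1 : Matrix (Fin n) (Fin n) ℝ) 0 w.ofLp
  simp [position, momentum, standardJ, h, Matrix.neg_mulVec]

theorem momentum_standardJ (R : Matrix (Fin n ⊕ Fin n) (Fin n ⊕ Fin n) ℝ) (z : PhaseSpace n) :
    momentum (Matrix.toEuclideanLin (standardJ n * R) z) =
      -position (Matrix.toEuclideanLin R z) := by
  rw [toEuclideanLin_mul_apply]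
  set w := Matrix.toEuclideanLin R z
  ext j
  have h := Matrix.fromBlocks_mulVec (0 : Matrix (Fin n) (Fin n) ℝ)
    (1 : Matrix (Fin n) (Fin n) ℝ) (-1 : Matrix (Fin n) (Fin n) ℝ) 0 w.ofLp
  simp [position, momentum, standardJ, h, Matrix.neg_mulVec]

theorem sum_sum_complex_quadForm {ι : Type*} [Fintype ι] [DecidableEq ι] {R : Matrix ι ι ℝ}
    (hR : R.IsSymm) (a b : EuclideanSpace ℝ ι) :
    ∑ α, ∑ β, (R α β : ℂ) * (((a α : ℂ) + Complex.I * b α) * ((a β : ℂ) + Complex.I * b β)) =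
      ((quadForm R a - quadForm R b : ℝ) : ℂ) +
        2 * Complex.I * (inner ℝ (Matrix.toEuclideanLin R a) b : ℝ) := by
  have hq : ∀ u v : EuclideanSpace ℝ ι, ((inner ℝ (Matrix.toEuclideanLin R u) v : ℝ) : ℂ) =
      ∑ α, ∑ β, (R α β : ℂ) * ((v α : ℂ) * (u β : ℂ)) := by
    intro u v
    simp only [PiLp.inner_apply, Matrix.ofLp_toLpLin, Matrix.toLin'_apply, Matrix.mulVec,
      dotProduct]
    push_cast
    simp only [RCLike.inner_apply, conj_trivial, Complex.ofReal_mul, Complex.ofReal_sum,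
      Finset.mul_sum]
    refine Finset.sum_congr rfl fun i _ => Finset.sum_congr rfl fun j _ => ?_
    ring
  have hs : inner ℝ (Matrix.toEuclideanLin R b) a = inner ℝ (Matrix.toEuclideanLin R a) b := by
    rw [inner_toEuclideanLin_left, hR, real_inner_comm]
  have h2 : (2 * Complex.I * (inner ℝ (Matrix.toEuclideanLin R a) b : ℝ) : ℂ) =
      Complex.I * (inner ℝ (Matrix.toEuclideanLin R a) b : ℝ) +
      Complex.I * (inner ℝ (Matrix.toEuclideanLin R b) a : ℝ) := by rw [hs]; ring
  rw [h2, quadForm_eq_inner, quadForm_eq_inner, Complex.ofReal_sub, hq, hq, hq, hq]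
  simp only [Finset.mul_sum, ← Finset.sum_add_distrib, ← Finset.sum_sub_distrib]
  refine Finset.sum_congr rfl fun i _ => Finset.sum_congr rfl fun j _ => ?_
  linear_combination ((R i j : ℂ) * b i * b j) * Complex.I_sq

theorem quadForm_matrix_add {ι : Type*} [Fintype ι] (A B : Matrix ι ι ℝ)
    (v : EuclideanSpace ℝ ι) : quadForm (A + B) v = quadForm A v + quadForm B v := by
  simp [quadForm, Matrix.add_mulVec]

theorem quadForm_matrix_sub {ι : Type*} [Fintype ι] (A B : Matrix ι ι ℝ)
    (v : EuclideanSpace ℝ ι) : quadForm (A - B) v = quadForm A v - quadForm B v := by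
  simp [quadForm, Matrix.sub_mulVec, sub_dotProduct]

theorem quadForm_mul (A B : Matrix (Fin n) (Fin n) ℝ) (v : ConfigSpace n) :
    quadForm (A * B) v = inner ℝ (Matrix.toEuclideanLin B v) (Matrix.toEuclideanLin Aᵀ v) := by
  rw [quadForm_eq_inner, toEuclideanLin_mul_apply, inner_toEuclideanLin_left]

/-- The symbol of the Hamiltonian at the complex point of a Gaussian wave, in terms of the
velocities of the parameters of the wave. -/
theorem sum_complexPoint {R : Matrix (Fin n ⊕ Fin n) (Fin n ⊕ Fin n) ℝ} (hR : R.IsSymm)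
    {X Y : Matrix (Fin n) (Fin n) ℝ} (hX : X.IsSymm) (hY : Y.IsSymm) (z₀ : PhaseSpace n)
    (x : ConfigSpace n) :
    let A := R.toBlocks₁₁
    let B := R.toBlocks₁₂
    let D := R.toBlocks₂₂
    let X' := X * D * Y + Y * D * X - B * X - X * Bᵀ
    let Y' := A - B * Y - Y * Bᵀ - X * D * X + Y * D * Y
    let z' := Matrix.toEuclideanLin (standardJ n * R) z₀
    let y := x - position z₀
    (1 / 2) * ∑ α, ∑ β, (R α β : ℂ) * (complexPoint X Y z₀ x α * complexPoint X Y z₀ x β) =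
      -((inner ℝ (momentum z') x - (1 / 2) * (inner ℝ (momentum z') (position z₀) +
        inner ℝ (momentum z₀) (position z')) : ℝ) : ℂ) -
      Complex.I / 2 * (((quadForm X' y - 2 * inner ℝ (Matrix.toEuclideanLin X y) (position z') : ℝ)
          : ℂ) +
        Complex.I * ((quadForm Y' y - 2 * inner ℝ (Matrix.toEuclideanLin Y y) (position z') : ℝ)
          : ℂ)) := by
  intro A B D X' Y' z' y
  have hDs : Dᵀ = D := toBlocks₂₂_isSymm hR
  unfold complexPoint
  -- The complex point is `(z₀ + (y, -Yy)) + i (0, Xy)`; its real and imaginary parts are expanded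
  -- separately.
  rw [sum_sum_complex_quadForm hR]
  set a := Matrix.toEuclideanLin X y with ha
  set b := Matrix.toEuclideanLin Y y with hb
  have hx : x = y + position z₀ := by simp [y]
  have hp : position z' = momentum (Matrix.toEuclideanLin R z₀) := position_standardJ R z₀
  have hm : momentum z' = -position (Matrix.toEuclideanLin R z₀) := momentum_standardJ R z₀
  -- Euler's identity for the homogeneous `H`. It matches the constant term `H(z₀)` with the
  -- derivative of the symmetric phase `p₀·x - ½ p₀·x₀` at the centre, so that no action integral
  -- has to be added to `c`.
  have hq0 : quadForm R z₀ = inner ℝ (position (Matrix.toEuclideanLin R z₀)) (position z₀) +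
      inner ℝ (momentum z₀) (momentum (Matrix.toEuclideanLin R z₀)) := by
    rw [quadForm_eq_inner, inner_position_momentum, real_inner_comm (momentum z₀)]
  have hDab : inner ℝ (Matrix.toEuclideanLin D a) b = inner ℝ (Matrix.toEuclideanLin D b) a := by
    rw [inner_toEuclideanLin_left, hDs, real_inner_comm]
  have hX' : quadForm X' y = 2 * inner ℝ (Matrix.toEuclideanLin D b) a -
      2 * inner ℝ (Matrix.toEuclideanLin Bᵀ y) a := by
    simp only [X', quadForm_matrix_add, quadForm_matrix_sub, mul_assoc, quadForm_mul,
      toEuclideanLin_mul_apply, hX.eq, hY.eq, ← ha, ← hb]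
    rw [hDab]
    linarith [real_inner_comm a (Matrix.toEuclideanLin D b),
      real_inner_comm a (Matrix.toEuclideanLin Bᵀ y)]
  have hY' : quadForm Y' y = quadForm A y - 2 * inner ℝ (Matrix.toEuclideanLin Bᵀ y) b -
      quadForm D a + quadForm D b := by
    simp only [Y', quadForm_matrix_add, quadForm_matrix_sub, mul_assoc, quadForm_mul,
      toEuclideanLin_mul_apply, hX.eq, hY.eq, ← ha, ← hb]
    rw [real_inner_comm b, quadForm_eq_inner D a, quadForm_eq_inner D b]
    ring
  have h1 : quadForm R (z₀ + joinPhase y (-b)) = quadForm R z₀ +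
      2 * (inner ℝ (position (Matrix.toEuclideanLin R z₀)) y -
        inner ℝ (momentum (Matrix.toEuclideanLin R z₀)) b) +
      (quadForm A y - 2 * inner ℝ (Matrix.toEuclideanLin Bᵀ y) b + quadForm D b) := by
    rw [quadForm_add R hR, inner_joinPhase, quadForm_joinPhase hR, quadForm_neg, inner_neg_right,
      inner_neg_right]
    ring
  have h2 : quadForm R (joinPhase 0 a) = quadForm D a := by
    rw [quadForm_joinPhase hR]
    simp [quadForm, D]
  have h3 : inner ℝ (Matrix.toEuclideanLin R (z₀ + joinPhase y (-b))) (joinPhase 0 a) =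
      inner ℝ (momentum (Matrix.toEuclideanLin R z₀)) a +
        (inner ℝ (Matrix.toEuclideanLin Bᵀ y) a - inner ℝ (Matrix.toEuclideanLin D b) a) := by
    rw [map_add, inner_add_left, inner_joinPhase, inner_joinPhase, inner_zero_right,
      inner_zero_right, toEuclideanLin_joinPhase, toBlocks₂₁_eq hR]
    change _ + (0 + inner ℝ (_ + _) a) = _
    rw [inner_add_left, map_neg, inner_neg_left]
    ring
  rw [h1, h2, h3, hX', hY', hp, hm, hq0, hx]
  simp only [inner_neg_left, inner_add_right]
  rw [real_inner_comm (momentum (Matrix.toEuclideanLin R z₀)) a,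
    real_inner_comm (momentum (Matrix.toEuclideanLin R z₀)) b]
  push_cast
  ring_nf
  simp only [Complex.I_sq]
  ring

end EnergyIdentity

/-! ### Gaussian waves solving Schrödinger's equation -/

section WaveEvolution

open Filter Topology

theorem hasDerivAt_quadForm {ι : Type*} [Fintype ι] [DecidableEq ι] {A : ℝ → Matrix ι ι ℝ}
    {A' : Matrix ι ι ℝ} {v : ℝ → EuclideanSpace ℝ ι} {v' : EuclideanSpace ℝ ι} {t : ℝ}
    (hA : HasDerivAt A A' t) (hs : (A t).IsSymm) (hv : ∀ i, HasDerivAt (fun s => v s i) (v' i) t) :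
    HasDerivAt (fun s => quadForm (A s) (v s))
      (quadForm A' (v t) + 2 * inner ℝ (Matrix.toEuclideanLin (A t) (v t)) v') t := by
  have hv' : HasDerivAt (fun s => (v s).ofLp) v'.ofLp t := hasDerivAt_pi.2 hv
  have h1 := hasDerivAt_pi.1 (hasDerivAt_matrix_mulVec hA hv')
  have h2 := HasDerivAt.fun_sum (u := Finset.univ) fun i _ => (h1 i).mul (hv i)
  refine h2.congr_deriv ?_
  have h3 : inner ℝ (Matrix.toEuclideanLin (A t) (v t)) v' =
      inner ℝ (Matrix.toEuclideanLin (A t) v') (v t) := by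
    rw [inner_toEuclideanLin_left, hs, real_inner_comm]
  rw [two_mul]
  nth_rewrite 1 [h3]
  simp only [quadForm, PiLp.inner_apply, Matrix.ofLp_toLpLin, Matrix.toLin'_apply, dotProduct,
    Pi.add_apply, add_mul, Finset.sum_add_distrib, RCLike.inner_apply, conj_trivial]
  simp only [mul_comm, add_assoc]

theorem hasDerivAt_inner_const {u : ℝ → ConfigSpace n} {u' : ConfigSpace n} {t : ℝ}
    (hu : ∀ i, HasDerivAt (fun s => u s i) (u' i) t) (x : ConfigSpace n) :
    HasDerivAt (fun s => inner ℝ (u s) x) (inner ℝ u' x) t := by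
  have h := HasDerivAt.fun_sum (u := Finset.univ) fun i _ => (hu i).const_mul (x i)
  simpa [PiLp.inner_apply] using h

theorem hasDerivAt_inner_curve {u v : ℝ → ConfigSpace n} {u' v' : ConfigSpace n} {t : ℝ}
    (hu : ∀ i, HasDerivAt (fun s => u s i) (u' i) t)
    (hv : ∀ i, HasDerivAt (fun s => v s i) (v' i) t) :
    HasDerivAt (fun s => inner ℝ (u s) (v s)) (inner ℝ u' (v t) + inner ℝ (u t) v') t := by
  have h := HasDerivAt.fun_sum (u := Finset.univ) fun i _ => (hv i).mul (hu i)
  refine (h.congr_deriv ?_).congr_of_eventuallyEq (Eventually.of_forall fun s => ?_)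
  · simp [PiLp.inner_apply, Finset.sum_add_distrib, add_comm]
  · simp [PiLp.inner_apply]

variable {ħ : ℝ} {X Y : ℝ → Matrix (Fin n) (Fin n) ℝ} {X' Y' : Matrix (Fin n) (Fin n) ℝ}
  {z : ℝ → PhaseSpace n} {z' : PhaseSpace n} {c : ℝ → ℂ} {c' : ℂ} {t : ℝ}

theorem hasDerivAt_gaussianExponent (ħ : ℝ) (hX : HasDerivAt X X' t) (hY : HasDerivAt Y Y' t)
    (hXs : (X t).IsSymm) (hYs : (Y t).IsSymm) (hz : ∀ α, HasDerivAt (fun s => z s α) (z' α) t)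
    (hc : HasDerivAt c c' t) (x : ConfigSpace n) :
    HasDerivAt (fun s => gaussianExponent ħ (X s) (Y s) (z s) (c s) x)
      (c' + (Complex.I / ħ * ((inner ℝ (momentum z') x - (1 / 2) *
          (inner ℝ (momentum z') (position (z t)) + inner ℝ (momentum (z t)) (position z')) : ℝ)
            : ℂ) +
        -(1 / (2 * (ħ : ℂ))) *
          (((quadForm X' (x - position (z t)) - 2 * inner ℝ
            (Matrix.toEuclideanLin (X t) (x - position (z t))) (position z') : ℝ) : ℂ) +
          Complex.I * ((quadForm Y' (x - position (z t)) - 2 * inner ℝ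
            (Matrix.toEuclideanLin (Y t) (x - position (z t))) (position z') : ℝ) : ℂ)))) t := by
  have hp : ∀ j, HasDerivAt (fun s => momentum (z s) j) (momentum z' j) t := fun j => hz _
  have hq : ∀ j, HasDerivAt (fun s => position (z s) j) (position z' j) t := fun j => hz _
  have hv : ∀ j, HasDerivAt (fun s => (x - position (z s)) j) ((-position z') j) t := by
    intro j
    simpa using (hq j).const_sub (x j)
  have h1 := (hasDerivAt_inner_const hp x).sub ((hasDerivAt_inner_curve hp hq).const_mul (1 / 2))
  have h2 := hasDerivAt_quadForm hX hXs hv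
  have h3 := hasDerivAt_quadForm hY hYs hv
  simp only [inner_neg_right, mul_neg, ← sub_eq_add_neg] at h2 h3
  exact hc.add ((h1.ofReal_comp.const_mul _).add
    ((h2.ofReal_comp.add (h3.ofReal_comp.const_mul _)).const_mul _))

theorem polyLipschitzAt_coord (j : Fin n) :
    PolyLipschitzAt 1 (fun _ (x : ConfigSpace n) => (x j : ℂ)) t := by
  refine polyLipschitzAt_fun fun x => ?_
  rw [Complex.norm_real, pow_one]
  have := PiLp.norm_apply_le x j
  linarith

theorem polyLipschitzAt_coord_sub (hz : ∀ α, HasDerivAt (fun s => z s α) (z' α) t) (j : Fin n) :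
    PolyLipschitzAt 1 (fun s (x : ConfigSpace n) => ((x - position (z s)) j : ℂ)) t := by
  have h1 : HasDerivAt (fun s => -((z s (Sum.inl j) : ℝ) : ℂ)) (-(z' (Sum.inl j) : ℂ)) t :=
    (hz (Sum.inl j)).ofReal_comp.neg
  have h := (polyLipschitzAt_coord (t := t) j).add
    ((polyLipschitzAt_of_hasDerivAt (V := ConfigSpace n) h1).mono zero_le_one)
  convert! h using 3
  simp [position, sub_eq_add_neg]

theorem polyLipschitzAt_quadForm (hX : HasDerivAt X X' t)
    (hz : ∀ α, HasDerivAt (fun s => z s α) (z' α) t) :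
    PolyLipschitzAt 2
      (fun s (x : ConfigSpace n) => (quadForm (X s) (x - position (z s)) : ℂ)) t := by
  have h : PolyLipschitzAt 2 (fun s (x : ConfigSpace n) => ∑ i, ∑ j, ((X s i j : ℝ) : ℂ) *
      (((x - position (z s)) j : ℂ) * ((x - position (z s)) i : ℂ))) t := by
    refine PolyLipschitzAt.sum _ fun i _ => PolyLipschitzAt.sum _ fun j _ => ?_
    exact (polyLipschitzAt_of_hasDerivAt (hasDerivAt_matrix_iff.1 hX i j).ofReal_comp).mul
      ((polyLipschitzAt_coord_sub hz j).mul (polyLipschitzAt_coord_sub hz i))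
  convert! h using 3
  simp [quadForm, dotProduct, Matrix.mulVec, Finset.sum_mul, mul_assoc]

/-- The exponent is a finite sum of differentiable functions of time times polynomials in `x`, of
total degree at most two. The resulting Lipschitz bound, uniform in `x` up to the weight, feeds the
domination in `hasDerivAt_Lp_exp`. -/
theorem polyLipschitzAt_gaussianExponent (ħ : ℝ) (hX : HasDerivAt X X' t) (hY : HasDerivAt Y Y' t)
    (hz : ∀ α, HasDerivAt (fun s => z s α) (z' α) t) (hc : HasDerivAt c c' t) :
    PolyLipschitzAt 2 (fun s => gaussianExponent ħ (X s) (Y s) (z s) (c s)) t := by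
  have hp : ∀ j, HasDerivAt (fun s => momentum (z s) j) (momentum z' j) t := fun j => hz _
  have hq : ∀ j, HasDerivAt (fun s => position (z s) j) (position z' j) t := fun j => hz _
  have h1 : PolyLipschitzAt 1 (fun s (x : ConfigSpace n) =>
      ((inner ℝ (momentum (z s)) x : ℝ) : ℂ)) t := by
    have h : PolyLipschitzAt 1 (fun s (x : ConfigSpace n) =>
        ∑ j, ((momentum (z s) j : ℝ) : ℂ) * (x j : ℂ)) t :=
      PolyLipschitzAt.sum _ fun j _ =>
        ((polyLipschitzAt_of_hasDerivAt (hp j).ofReal_comp).mul (polyLipschitzAt_coord j)).mono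
          (by norm_num)
    convert! h using 3
    simp [PiLp.inner_apply, mul_comm]
  have h2 : PolyLipschitzAt 0 (fun s (_ : ConfigSpace n) =>
      ((-((1 / 2) * inner ℝ (momentum (z s)) (position (z s))) : ℝ) : ℂ)) t :=
    polyLipschitzAt_of_hasDerivAt
      (((hasDerivAt_inner_curve hp hq).const_mul (1 / 2)).neg.ofReal_comp)
  have h3 : PolyLipschitzAt 1 (fun s (x : ConfigSpace n) => ((inner ℝ (momentum (z s)) x -
      (1 / 2) * inner ℝ (momentum (z s)) (position (z s)) : ℝ) : ℂ)) t := by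
    convert! h1.add (h2.mono zero_le_one) using 3
    push_cast
    ring
  refine ((polyLipschitzAt_of_hasDerivAt hc).mono (Nat.zero_le 2)).add (PolyLipschitzAt.add ?_ ?_)
  · exact ((polyLipschitzAt_const _).mul h3).mono (by norm_num)
  · exact ((polyLipschitzAt_const _).mul ((polyLipschitzAt_quadForm hX hz).add
      (((polyLipschitzAt_const _).mul (polyLipschitzAt_quadForm hY hz)).mono (by norm_num)))).mono
        (by norm_num)

/-- A Gaussian wave whose centre follows the classical motion, whose covariance data satisfy the
Riccati equation, and whose amplitude satisfies the transport equation, solves Schrödinger's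
equation in `L²`. -/
theorem hasDerivAt_gaussianWave (hħ : 0 < ħ)
    {R : Matrix (Fin n ⊕ Fin n) (Fin n ⊕ Fin n) ℝ} (hR : R.IsSymm)
    (hXp : ∀ s, (X s).PosDef) (hYs : ∀ s, (Y s).IsSymm)
    (hX : HasDerivAt X (X t * R.toBlocks₂₂ * Y t + Y t * R.toBlocks₂₂ * X t -
      R.toBlocks₁₂ * X t - X t * R.toBlocks₁₂ᵀ) t)
    (hY : HasDerivAt Y (R.toBlocks₁₁ - R.toBlocks₁₂ * Y t - Y t * R.toBlocks₁₂ᵀ -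
      X t * R.toBlocks₂₂ * X t + Y t * R.toBlocks₂₂ * Y t) t)
    (hXi : ContinuousAt (fun s => (X s)⁻¹) t)
    (hz : ∀ α, HasDerivAt (fun s => z s α) (Matrix.toEuclideanLin (standardJ n * R) (z t) α) t)
    (hc : HasDerivAt c (-(1 / 2) * ((R.toBlocks₁₂.trace : ℝ) +
      Complex.I * (((R.toBlocks₂₂ * X t).trace : ℝ) +
        Complex.I * ((R.toBlocks₂₂ * Y t).trace : ℝ)))) t) :
    HasDerivAt (fun s => (gaussianWave hħ (hXp s) (Y s) (z s) (c s)).toLp 2 volume)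
      ((Complex.I * (ħ : ℂ))⁻¹ •
        (weylHamiltonian ħ R (gaussianWave hħ (hXp t) (Y t) (z t) (c t))).toLp 2 volume) t := by
  have hħ' : (ħ : ℂ) ≠ 0 := by exact_mod_cast hħ.ne'
  have hXs : ∀ s, (X s).IsSymm := fun s => isSymm_of_posDef (hXp s)
  obtain ⟨K, hK0, hK⟩ := polyLipschitzAt_gaussianExponent ħ hX hY hz hc
  -- The added `1`, here and in `B`, leaves room for the bounds at time `t` to persist nearby, by
  -- continuity.
  set L := (∑ i, ∑ j, |(X t)⁻¹ i j|) + 1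
  have hL : 0 < L := by positivity
  have hLt : ∀ᶠ s in 𝓝 t, ∑ i, ∑ j, |(X s)⁻¹ i j| < L := by
    have hcont : ContinuousAt (fun s => ∑ i, ∑ j, |(X s)⁻¹ i j|) t := by
      refine tendsto_finsetSum _ fun i _ => tendsto_finsetSum _ fun j _ => ?_
      exact ((continuous_apply_apply i j).continuousAt.comp hXi).abs
    exact hcont.eventually_lt continuousAt_const (lt_add_one _)
  set B := max ‖position (z t)‖ (c t).re + 1
  have hzB : ∀ᶠ s in 𝓝 t, ‖position (z s)‖ < B := by
    have hcont : ContinuousAt (fun s => position (z s)) t :=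
      (PiLp.continuous_toLp 2 _).continuousAt.comp
        (tendsto_pi_nhds.2 fun j => (hz (Sum.inl j)).continuousAt)
    exact hcont.norm.eventually_lt continuousAt_const
      ((le_max_left _ _).trans_lt (lt_add_one _))
  have hcB : ∀ᶠ s in 𝓝 t, (c s).re < B :=
    (Complex.continuous_re.continuousAt.comp hc.continuousAt).eventually_lt continuousAt_const
      ((le_max_right _ _).trans_lt (lt_add_one _))
  refine hasDerivAt_Lp_exp (K := K) (C := B + 1 / (2 * ħ * L) * B ^ 2) (c := 1 / (4 * ħ * L))
    (by positivity) (fun s => SchwartzMap.coeFn_toLp _ 2 volume) ?_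
    (fun x => hasDerivAt_gaussianExponent ħ hX hY (hXs t) (hYs t) hz hc x)
    (hK.mono fun s hs x => (hs x).2) ?_
  · filter_upwards [Lp.coeFn_smul (Complex.I * (ħ : ℂ))⁻¹ ((weylHamiltonian ħ R
      (gaussianWave hħ (hXp t) (Y t) (z t) (c t))).toLp 2 volume),
      SchwartzMap.coeFn_toLp (weylHamiltonian ħ R
        (gaussianWave hħ (hXp t) (Y t) (z t) (c t))) 2 volume] with x h1 h2
    rw [h1, Pi.smul_apply, h2, weylHamiltonian_gaussian hħ R (hXp t) (hYs t),
      sum_orderingTerm hR (hXs t) (hYs t), sum_complexPoint hR (hXs t) (hYs t),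
      gaussianWave_apply, smul_eq_mul, mul_comm (Complex.exp _), ← mul_assoc]
    congr 1
    rw [inv_mul_eq_iff_eq_mul₀ (mul_ne_zero Complex.I_ne_zero hħ')]
    have e1 : (ħ : ℂ) * (1 / (2 * ħ)) = 1 / 2 := by field_simp
    have e2 : (ħ : ℂ) * (Complex.I / ħ) = Complex.I := by field_simp
    -- Here `P` is the phase velocity, `Q` and `W` are the velocities of the `X`- and `Y`-forms, and
    -- `a` is the rate of `c`: the symbol is `iħ` times the derivative of the exponent.
    have key : ∀ P Q W a : ℂ, -P - Complex.I / 2 * (Q + Complex.I * W) + Complex.I * ħ * a =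
        Complex.I * ħ * (a + (Complex.I / ħ * P + -(1 / (2 * (ħ : ℂ))) * (Q + Complex.I * W))) := by
      intro P Q W a
      linear_combination (-(Complex.I * P)) * e2 + (Complex.I * (Q + Complex.I * W)) * e1 -
        P * Complex.I_sq
    exact key _ _ _ _
  · filter_upwards [hLt, hzB, hcB] with s h1 h2 h3
    refine gaussianExponent_re_le hħ (hXp s) (Y s) hL (fun v => ?_) h2.le h3.le
    exact (quadForm_le_sum_abs _ v).trans (by gcongr)

end WaveEvolution

/-! ### Weak and strong solutions of Schrödinger's equation -/

section WeakSolutions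

open Filter Topology

/-- Symmetry of the coordinates: position multiplies by a real function, and for momentum
integration by parts gives a sign that conjugation of `i` cancels. -/
theorem inner_quantizedCoord (ħ : ℝ) (α : Fin n ⊕ Fin n) (φ ψ : 𝓢(ConfigSpace n, ℂ)) :
    inner ℂ ((quantizedCoord ħ α φ).toLp 2 volume) (ψ.toLp 2 volume) =
      inner ℂ (φ.toLp 2 volume) ((quantizedCoord ħ α ψ).toLp 2 volume) := by
  simp only [SchwartzMap.inner_toL2_toL2_eq, RCLike.inner_apply]
  rcases α with j | j
  · refine integral_congr_ae (Eventually.of_forall fun x => ?_)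
    simp only [quantizedCoord_inl_apply, map_mul, Complex.conj_ofReal]
    ring
  · have h := SchwartzMap.integral_bilinear_lineDerivOp_right_eq_neg_left (μ := volume) φ ψ
      ((ContinuousLinearMap.mul ℝ ℂ).comp (Complex.conjCLE : ℂ →L[ℝ] ℂ))
      (EuclideanSpace.single j (1 : ℝ))
    simp only [ContinuousLinearMap.comp_apply, ContinuousLinearMap.mul_apply',
      SchwartzMap.lineDerivOp_apply] at h
    simp only [quantizedCoord_inr_apply, map_mul, map_neg, Complex.conj_I, Complex.conj_ofReal]
    have e1 : ∀ x, ψ x * (-(-Complex.I * (ħ : ℂ)) * (starRingEnd ℂ)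
        (lineDeriv ℝ φ x (EuclideanSpace.single j (1 : ℝ)))) = (Complex.I * ħ) *
        ((starRingEnd ℂ) (lineDeriv ℝ φ x (EuclideanSpace.single j (1 : ℝ))) * ψ x) := by
      intro x; ring
    have e2 : ∀ x, -(Complex.I * (ħ : ℂ)) * lineDeriv ℝ ψ x (EuclideanSpace.single j (1 : ℝ)) *
        (starRingEnd ℂ) (φ x) = -(Complex.I * ħ) *
        ((starRingEnd ℂ) (φ x) * lineDeriv ℝ ψ x (EuclideanSpace.single j (1 : ℝ))) := by
      intro x; ring
    simp_rw [e1, e2, integral_const_mul]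
    have h' : ∫ x, (starRingEnd ℂ) (φ x) * lineDeriv ℝ ψ x (EuclideanSpace.single j (1 : ℝ)) =
        -∫ x, (starRingEnd ℂ) (lineDeriv ℝ φ x (EuclideanSpace.single j (1 : ℝ))) * ψ x := h
    rw [h']
    ring

theorem inner_weylHamiltonian (ħ : ℝ) (R : Matrix (Fin n ⊕ Fin n) (Fin n ⊕ Fin n) ℝ)
    (φ ψ : 𝓢(ConfigSpace n, ℂ)) :
    inner ℂ ((weylHamiltonian ħ R φ).toLp 2 volume) (ψ.toLp 2 volume) =
      inner ℂ (φ.toLp 2 volume) ((weylHamiltonian ħ R ψ).toLp 2 volume) := by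
  simp only [← SchwartzMap.toLpCLM_apply (𝕜 := ℂ)]
  simp only [weylHamiltonian, smul_apply, sum_apply, add_apply, ContinuousLinearMap.comp_apply,
    map_smul, map_sum, map_add, inner_smul_left, inner_smul_right, sum_inner, inner_sum,
    inner_add_left, inner_add_right]
  simp only [SchwartzMap.toLpCLM_apply, inner_quantizedCoord]
  simp only [map_div₀, map_one, map_ofNat, Complex.conj_ofReal]
  congr 1
  refine Finset.sum_congr rfl fun α _ => Finset.sum_congr rfl fun β _ => ?_
  ring

/-- A product rule in which `Ψ` is differentiable only against the frozen vector `u t`. The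
difference quotient splits as `⟨slope u, Ψ s⟩` plus the slope of `⟨u t, Ψ s⟩`; for the first term,
continuity of `Ψ` suffices. -/
theorem hasDerivAt_inner_of_weak {E : Type*} [NormedAddCommGroup E] [InnerProductSpace ℂ E]
    {u Ψ : ℝ → E} {u' : E} {d : ℂ} {t : ℝ} (hu : HasDerivAt u u' t) (hΨ : ContinuousAt Ψ t)
    (hd : HasDerivAt (fun s => inner ℂ (u t) (Ψ s)) d t) :
    HasDerivAt (fun s => inner ℂ (u s) (Ψ s)) (inner ℂ u' (Ψ t) + d) t := by
  rw [hasDerivAt_iff_tendsto_slope] at hu hd ⊢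
  have h1 : Tendsto (fun s => inner ℂ (slope u t s) (Ψ s)) (𝓝[≠] t) (𝓝 (inner ℂ u' (Ψ t))) :=
    hu.inner (hΨ.tendsto.mono_left nhdsWithin_le_nhds)
  refine (h1.add hd).congr fun s => ?_
  simp only [slope_def_module]
  rw [← Complex.coe_smul (s - t)⁻¹ (u s - u t), inner_smul_left, inner_sub_left,
    Complex.conj_ofReal, ← Complex.coe_smul, ← Complex.coe_smul, smul_eq_mul, smul_eq_mul]
  ring

variable {ħ : ℝ} {R : Matrix (Fin n ⊕ Fin n) (Fin n ⊕ Fin n) ℝ}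

/-- A curve of Schwartz functions which solves Schrödinger's equation strongly in `L²`. -/
def IsStrongSolution (ħ : ℝ) (R : Matrix (Fin n ⊕ Fin n) (Fin n ⊕ Fin n) ℝ)
    (g : ℝ → 𝓢(ConfigSpace n, ℂ)) : Prop :=
  ∀ t, HasDerivAt (fun s => (g s).toLp 2 (volume : Measure (ConfigSpace n)))
    ((Complex.I * (ħ : ℂ))⁻¹ • (weylHamiltonian ħ R (g t)).toLp 2 volume) t

theorem IsStrongSolution.isSchrodingerSolution {g : ℝ → 𝓢(ConfigSpace n, ℂ)}
    (hg : IsStrongSolution ħ R g) :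
    IsSchrodingerSolution ħ R fun s => (g s).toLp 2 volume := by
  refine ⟨continuous_iff_continuousAt.2 fun t => (hg t).continuousAt, fun φ t => ?_⟩
  have h := (hasDerivAt_const t (φ.toLp 2 (volume : Measure (ConfigSpace n)))).inner ℂ (hg t)
  refine h.congr_deriv ?_
  rw [inner_smul_right, inner_zero_left, add_zero, inner_weylHamiltonian]

theorem IsStrongSolution.comp_sub {g : ℝ → 𝓢(ConfigSpace n, ℂ)} (hg : IsStrongSolution ħ R g)
    (T : ℝ) : IsStrongSolution ħ R fun s => g (s - T) := by
  intro t
  exact (hg (t - T)).comp_sub_const t T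

/-- The strong and the weak equation contribute multiples of the same number `⟨Ĥ g, Ψ⟩`, with the
coefficients `(iħ)⁻¹` and its conjugate, which cancel. The value `g t` is a Schwartz function and so
may serve as the test function of the weak equation at time `t`. -/
theorem IsStrongSolution.inner_eq {g : ℝ → 𝓢(ConfigSpace n, ℂ)} (hg : IsStrongSolution ħ R g)
    {Ψ : ℝ → StateSpace n} (hΨ : IsSchrodingerSolution ħ R Ψ) (s t : ℝ) :
    inner ℂ ((g s).toLp 2 volume) (Ψ s) = inner ℂ ((g t).toLp 2 volume) (Ψ t) := by
  have hd : ∀ t, HasDerivAt (fun s => inner ℂ ((g s).toLp 2 volume) (Ψ s)) 0 t := by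
    intro t
    have h := hasDerivAt_inner_of_weak (hg t) hΨ.1.continuousAt (hΨ.2 (g t) t)
    refine h.congr_deriv ?_
    rw [inner_smul_left, ← add_mul, map_inv₀, map_mul, Complex.conj_I, Complex.conj_ofReal,
      neg_mul, inv_neg, neg_add_cancel, zero_mul]
  exact is_const_of_deriv_eq_zero (fun s => (hd s).differentiableAt) (fun s => (hd s).deriv) s t

end WeakSolutions

/-! ### Momentum translates of a Gaussian are total -/

section Totality

open scoped FourierTransform ContDiff

/-- Every test function `G` is the Fourier transform of a Schwartz function `ψ`, and moving the
transform across the pairing gives `∫ G h = ∫ ψ 𝓕h = 0`. -/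
theorem ae_eq_zero_of_fourier_eq_zero {V : Type*} [NormedAddCommGroup V] [InnerProductSpace ℝ V]
    [FiniteDimensional ℝ V] [MeasurableSpace V] [BorelSpace V] {h : V → ℂ} (hi : Integrable h)
    (h0 : ∀ w, 𝓕 h w = 0) : h =ᵐ[volume] 0 := by
  refine ae_eq_zero_of_integral_contDiff_smul_eq_zero hi.locallyIntegrable fun g hg hgs => ?_
  have hg₁ : HasCompactSupport (Complex.ofRealCLM ∘ g) := hgs.comp_left rfl
  have hg₂ : ContDiff ℝ ∞ (Complex.ofRealCLM ∘ g) := by fun_prop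
  set G : 𝓢(V, ℂ) := hg₁.toSchwartzMap hg₂
  set ψ : 𝓢(V, ℂ) := 𝓕⁻ G
  have h1 : ∫ ξ, 𝓕 (ψ : V → ℂ) ξ * h ξ = ∫ x, ψ x * 𝓕 h x := by
    simpa using! VectorFourier.integral_bilin_fourierIntegral_eq_flip (ContinuousLinearMap.mul ℂ ℂ)
      (L := innerₗ V) Real.continuous_fourierChar continuous_inner ψ.integrable hi
  have h2 : 𝓕 (ψ : V → ℂ) = G := by
    rw [← SchwartzMap.fourier_coe, FourierTransform.fourier_fourierInv_eq]
  rw [h2] at h1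
  simp only [h0, mul_zero, integral_zero] at h1
  rw [← h1]
  refine integral_congr_ae (Filter.Eventually.of_forall fun x => ?_)
  simp [G]

theorem eq_zero_of_inner_coherentState {ħ : ℝ} (hħ : 0 < ħ) {X : Matrix (Fin n) (Fin n) ℝ}
    (hX : X.PosDef) (c : ℂ) (f : StateSpace n)
    (h : ∀ p : ConfigSpace n,
      inner ℂ ((gaussianWave hħ hX 0 (joinPhase 0 p) c).toLp 2 volume) f = 0) : f = 0 := by
  set φ := gaussianWave hħ hX 0 (joinPhase 0 0) c
  have hφ : ∀ p x, gaussianWave hħ hX 0 (joinPhase 0 p) c x =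
      Complex.exp (Complex.I / ħ * (inner ℝ p x : ℝ)) * φ x := by
    intro p x
    have e1 : ∀ p : ConfigSpace n, position (joinPhase 0 p) = 0 := fun _ => rfl
    have e2 : ∀ p : ConfigSpace n, momentum (joinPhase 0 p) = p := fun _ => rfl
    rw [gaussianWave_apply, gaussianWave_apply, ← Complex.exp_add]
    simp only [gaussianExponent, e1, e2, inner_zero_left, inner_zero_right]
    congr 1
    push_cast
    ring
  have hint : Integrable (fun x => f x * (starRingEnd ℂ) (φ x)) := by
    have h1 := L2.integrable_inner (𝕜 := ℂ) (φ.toLp 2 volume) f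
    refine h1.congr ?_
    filter_upwards [SchwartzMap.coeFn_toLp φ 2 volume] with x hx
    rw [hx, RCLike.inner_apply]
  -- The inner product with the wave of momentum `p` is the Fourier transform of `f φ̄` at
  -- `p/(2πħ)`. Since `φ` never vanishes, `f φ̄ = 0` then forces `f = 0`.
  have hF : ∀ w, 𝓕 (fun x => f x * (starRingEnd ℂ) (φ x)) w = 0 := by
    intro w
    rw [Real.fourier_eq', ← h ((2 * Real.pi * ħ) • w), L2.inner_def]
    refine integral_congr_ae ?_
    filter_upwards [SchwartzMap.coeFn_toLp (gaussianWave hħ hX 0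
      (joinPhase 0 ((2 * Real.pi * ħ) • w)) c) 2 volume] with x hx
    have hħ' : (ħ : ℂ) ≠ 0 := by exact_mod_cast hħ.ne'
    rw [hx, RCLike.inner_apply, hφ ((2 * Real.pi * ħ) • w), map_mul, ← Complex.exp_conj, smul_eq_mul, mul_left_comm]
    congr 2
    rw [real_inner_smul_left, real_inner_comm w x, map_mul, map_div₀, Complex.conj_I,
      Complex.conj_ofReal, Complex.conj_ofReal]
    push_cast
    field_simp
  have h0 := ae_eq_zero_of_fourier_eq_zero hint hF
  rw [Lp.eq_zero_iff_ae_eq_zero]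
  filter_upwards [h0] with x hx
  have hne : (starRingEnd ℂ) (φ x) ≠ 0 := by
    rw [Ne, map_eq_zero]
    exact Complex.exp_ne_zero _
  exact (mul_eq_zero.1 hx).resolve_right hne

end Totality

/-! ### The quantum evolution of Gaussians and uniqueness -/

section GaussianFlow

variable {ħ : ℝ} (hħ : 0 < ħ) {R : Matrix (Fin n ⊕ Fin n) (Fin n ⊕ Fin n) ℝ}
  {X Y : Matrix (Fin n) (Fin n) ℝ}

/-- The logarithmic derivative of the amplitude of an evolving Gaussian wave. -/
def amplitudeRate (R G : Matrix (Fin n ⊕ Fin n) (Fin n ⊕ Fin n) ℝ) (t : ℝ) : ℂ :=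
  -(1 / 2) * ((R.toBlocks₁₂.trace : ℝ) +
    Complex.I * (((R.toBlocks₂₂ * blobX (transportedMatrix R G t)).trace : ℝ) +
      Complex.I * ((R.toBlocks₂₂ * blobY (transportedMatrix R G t)).trace : ℝ)))

/-- The Gaussian wave transported by the quantum evolution. -/
def gaussianFlow (R : Matrix (Fin n ⊕ Fin n) (Fin n ⊕ Fin n) ℝ) (hX : X.PosDef) (hY : Y.IsSymm)
    (z₀ : PhaseSpace n) (c : ℂ) (t : ℝ) : 𝓢(ConfigSpace n, ℂ) :=
  gaussianWave hħ (posDef_blobX (posDef_transportedMatrix (R := R) (posDef_blobMatrix hX hY) t))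
    (blobY (transportedMatrix R (blobMatrix X Y) t))
    (Matrix.toEuclideanLin (classicalFlow R t) z₀)
    (c + ∫ s in (0 : ℝ)..t, amplitudeRate R (blobMatrix X Y) s)

theorem gaussianFlow_zero (hX : X.PosDef) (hY : Y.IsSymm) (z₀ : PhaseSpace n) (c : ℂ) :
    gaussianFlow hħ R hX hY z₀ c 0 = gaussianWave hħ hX Y z₀ c := by
  ext x
  rw [gaussianFlow, gaussianWave_apply, gaussianWave_apply, transportedMatrix_zero,
    blobX_blobMatrix Y hX, blobY_blobMatrix Y hX, classicalFlow_zero, toEuclideanLin_one_apply,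
    intervalIntegral.integral_same, add_zero]

theorem continuous_amplitudeRate (hR : R.IsSymm) (hX : X.PosDef) (hY : Y.IsSymm) :
    Continuous (amplitudeRate R (blobMatrix X Y)) := by
  have h := hasDerivAt_blobX_blobY hR (posDef_blobMatrix hX hY)
    (blobMatrix_mem_symplecticGroup hX hY)
  have hXc : Continuous fun t => blobX (transportedMatrix R (blobMatrix X Y) t) :=
    continuous_matrix fun i j => continuous_iff_continuousAt.2 fun t =>
      (hasDerivAt_matrix_iff.1 (h t).1 i j).continuousAt
  have hYc : Continuous fun t => blobY (transportedMatrix R (blobMatrix X Y) t) :=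
    continuous_matrix fun i j => continuous_iff_continuousAt.2 fun t =>
      (hasDerivAt_matrix_iff.1 (h t).2 i j).continuousAt
  unfold amplitudeRate
  have h1 := Complex.continuous_ofReal.comp (continuous_const (y := R.toBlocks₂₂) |>.matrix_mul
    hXc).matrix_trace
  have h2 := Complex.continuous_ofReal.comp (continuous_const (y := R.toBlocks₂₂) |>.matrix_mul
    hYc).matrix_trace
  exact continuous_const.mul (continuous_const.add
    (continuous_const.mul (h1.add (continuous_const.mul h2))))

theorem isStrongSolution_gaussianFlow (hR : R.IsSymm) (hX : X.PosDef) (hY : Y.IsSymm)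
    (z₀ : PhaseSpace n) (c : ℂ) : IsStrongSolution ħ R (gaussianFlow hħ R hX hY z₀ c) := by
  intro t
  have hG := posDef_blobMatrix hX hY
  have hGs := blobMatrix_mem_symplecticGroup hX hY
  obtain ⟨hX', hY'⟩ := hasDerivAt_blobX_blobY hR hG hGs t
  refine hasDerivAt_gaussianWave hħ hR
    (fun s => posDef_blobX (posDef_transportedMatrix (R := R) hG s))
    (fun s => (isSymm_blobY_and_blobMatrix_eq (posDef_transportedMatrix hG s)
      (transportedMatrix_mem_symplecticGroup hR hGs s)).1) hX' hY' ?_ ?_ ?_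
  -- `X_t⁻¹` is the lower right block of `G_t`, so its continuity requires no inversion.
  · have h : (fun s => (blobX (transportedMatrix R (blobMatrix X Y) s))⁻¹) =
        fun s => (transportedMatrix R (blobMatrix X Y) s).toBlocks₂₂ := by
      funext s
      exact Matrix.nonsing_inv_nonsing_inv _
        (isUnit_det_of_posDef (posDef_toBlocks₂₂ (posDef_transportedMatrix hG s)))
    rw [h]
    refine tendsto_pi_nhds.2 fun i => tendsto_pi_nhds.2 fun j => ?_
    exact (hasDerivAt_matrix_iff.1 (hasDerivAt_transportedMatrix t) (Sum.inr i)
      (Sum.inr j)).continuousAt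
  · intro α
    have h := hasDerivAt_pi.1 (hasDerivAt_matrix_mulVec (hasDerivAt_classicalFlow R t)
      (hasDerivAt_const t z₀.ofLp)) α
    convert! h using 1
    simp [Matrix.mulVec_mulVec, mul_assoc]
  · exact ((continuous_amplitudeRate hR hX hY).integral_hasStrictDerivAt 0 t).hasDerivAt.const_add c

/-- Weak solutions of Schrödinger's equation are determined by their initial values. -/
theorem IsSchrodingerSolution.unique {ħ : ℝ} (hħ : 0 < ħ)
    {R : Matrix (Fin n ⊕ Fin n) (Fin n ⊕ Fin n) ℝ} (hR : R.IsSymm) {Ψ Ψ' : ℝ → StateSpace n}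
    (hΨ : IsSchrodingerSolution ħ R Ψ) (hΨ' : IsSchrodingerSolution ħ R Ψ')
    (h0 : Ψ 0 = Ψ' 0) : Ψ = Ψ' := by
  funext T
  rw [← sub_eq_zero]
  refine eq_zero_of_inner_coherentState hħ (X := 1) Matrix.PosDef.one 0 _ fun p => ?_
  -- The Gaussian solution is shifted in time so as to reach the prescribed test Gaussian at time
  -- `T`; conservation moves the pairing back to time `0`, where the two solutions agree.
  have hg := (isStrongSolution_gaussianFlow hħ hR (X := 1) (Y := 0) Matrix.PosDef.one
    Matrix.isSymm_zero (joinPhase 0 p) 0).comp_sub T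
  have h1 := hg.inner_eq hΨ T 0
  have h2 := hg.inner_eq hΨ' T 0
  simp only [sub_self, gaussianFlow_zero] at h1 h2
  rw [inner_sub_right, h1, h2, h0, sub_self]

theorem norm_sq_toLp (φ : 𝓢(ConfigSpace n, ℂ)) :
    inner ℂ (φ.toLp 2 (volume : Measure (ConfigSpace n))) (φ.toLp 2 volume) =
      ((∫ x, ‖φ x‖ ^ 2 : ℝ) : ℂ) := by
  refine (SchwartzMap.inner_toL2_toL2_eq φ φ volume).trans ?_
  rw [← integral_complex_ofReal]
  refine integral_congr_ae (Filter.Eventually.of_forall fun x => ?_)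
  simp only [RCLike.inner_apply, Complex.mul_conj, Complex.normSq_eq_norm_sq]

/-- A normalized Gaussian wave is a squeezed coherent state. -/
theorem exists_gaussianWave_eq_coherentState (hX : X.PosDef) (hY : Y.IsSymm) (z₀ : PhaseSpace n)
    (c : ℂ) (h : ∫ x, ‖gaussianWave hħ hX Y z₀ c x‖ ^ 2 = 1) :
    ∃ γ : ℝ, (gaussianWave hħ hX Y z₀ c : ConfigSpace n → ℂ) = coherentState ħ X Y z₀ γ := by
  set l := Real.log ((Real.pi * ħ) ^ (-(n : ℝ) / 4) * X.det ^ (1 / 4 : ℝ)) with hl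
  have hħ' : (ħ : ℂ) ≠ 0 := by exact_mod_cast hħ.ne'
  have e1 : coherentState ħ X Y z₀ 0 = gaussianWave hħ hX Y z₀ (l : ℂ) :=
    coherentState_eq hħ hX Y z₀ 0 (by simp [hl])
  have e2 : ∀ x, gaussianWave hħ hX Y z₀ c x =
      Complex.exp (c - l) * coherentState ħ X Y z₀ 0 x := by
    intro x
    rw [e1, gaussianWave_apply, gaussianWave_apply, ← Complex.exp_add]
    congr 1
    simp only [gaussianExponent]
    ring
  -- The wave is `exp (c - l)` times a normalized state, so unit norm forces `Re c = l`. The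
  -- remaining imaginary part is the phase `γ/ħ`.
  simp_rw [e2, norm_mul, mul_pow] at h
  rw [integral_const_mul, integral_norm_sq_coherentState hħ hX hY, mul_one, Complex.norm_exp,
    ← Real.exp_nat_mul, Real.exp_eq_one_iff, Complex.sub_re, Complex.ofReal_re] at h
  have hre : c.re = l := by
    have : c.re - l = 0 := by simpa using h
    linarith
  refine ⟨ħ * c.im, (coherentState_eq hħ hX Y z₀ _ ?_).symm⟩
  rw [← hl, ← hre]
  push_cast
  rw [← mul_assoc, div_mul_cancel₀ _ hħ', mul_comm, Complex.re_add_im]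

theorem coherentState_eq_gaussianWave (hX : X.PosDef) (Y : Matrix (Fin n) (Fin n) ℝ)
    (z₀ : PhaseSpace n) (γ : ℝ) :
    ∃ c : ℂ, coherentState ħ X Y z₀ γ = gaussianWave hħ hX Y z₀ c :=
  ⟨_, coherentState_eq hħ hX Y z₀ γ rfl⟩

/-- Only the modulus of the amplitude is in question. Conservation of the norm fixes it, in place of
a comparison of the integrated traces with `log det X_t`. -/
theorem exists_gaussianFlow_eq_coherentState (hR : R.IsSymm) (hX : X.PosDef) (hY : Y.IsSymm)
    (z₀ : PhaseSpace n) (γ : ℝ) {c : ℂ}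
    (hc : coherentState ħ X Y z₀ γ = gaussianWave hħ hX Y z₀ c) (t : ℝ) :
    ∃ γ' : ℝ, (gaussianFlow hħ R hX hY z₀ c t : ConfigSpace n → ℂ) =
      coherentState ħ (blobX (transportedMatrix R (blobMatrix X Y) t))
        (blobY (transportedMatrix R (blobMatrix X Y) t))
        (Matrix.toEuclideanLin (classicalFlow R t) z₀) γ' := by
  have hG := posDef_blobMatrix hX hY
  have hGs := blobMatrix_mem_symplecticGroup hX hY
  refine exists_gaussianWave_eq_coherentState hħ _
    (isSymm_blobY_and_blobMatrix_eq (posDef_transportedMatrix hG t)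
      (transportedMatrix_mem_symplecticGroup hR hGs t)).1 _ _ ?_
  have hs := isStrongSolution_gaussianFlow hħ hR hX hY z₀ c
  have h := hs.inner_eq hs.isSchrodingerSolution t 0
  rw [norm_sq_toLp, norm_sq_toLp, Complex.ofReal_inj, gaussianFlow_zero, ← hc,
    integral_norm_sq_coherentState hħ hX hY] at h
  exact h

end GaussianFlow

/-! ### Correspondence between states and blobs -/

section Correspondence

theorem exists_quantumBlob_eq {ħ : ℝ} (hħ : 0 < ħ) {X Y : Matrix (Fin n) (Fin n) ℝ}
    (hX : X.PosDef) (hY : Y.IsSymm) (z₀ : PhaseSpace n) :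
    ∃ S ∈ Matrix.symplecticGroup (Fin n) ℝ,
      quantumBlob ħ z₀ S = {z | quadForm (blobMatrix X Y) (z - z₀) ≤ ħ} := by
  obtain ⟨M, hM, h⟩ := exists_symplectic_blobMatrix hX hY
  have hMi := symplectic_inv_mem hM
  refine ⟨M⁻¹, hMi, ?_⟩
  rw [quantumBlob_eq_quadForm hħ.le z₀ (SymplecticGroup.symplectic_det hMi),
    Matrix.nonsing_inv_nonsing_inv _ (SymplecticGroup.symplectic_det hM), h]

/-- The ellipsoid matrix `S⁻ᵀ S⁻¹` of the blob is positive definite and symplectic, so it is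
`blobMatrix X Y` for the parameters read off from its blocks. -/
theorem exists_state_of_symplectic {ħ : ℝ} (hħ : 0 < ħ) (z₀ : PhaseSpace n)
    {S : Matrix (Fin n ⊕ Fin n) (Fin n ⊕ Fin n) ℝ} (hS : S ∈ Matrix.symplecticGroup (Fin n) ℝ) :
    ∃ Ψ₀ : StateSpace n, IsSqueezedCoherentState ħ Ψ₀ ∧
      CorrespondsTo ħ Ψ₀ (quantumBlob ħ z₀ S) := by
  have hSi := symplectic_inv_mem hS
  have hG : ((S⁻¹)ᵀ * S⁻¹).PosDef :=
    posDef_transpose_mul_self (SymplecticGroup.symplectic_det hSi)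
  have hGs : (S⁻¹)ᵀ * S⁻¹ ∈ Matrix.symplecticGroup (Fin n) ℝ :=
    mul_mem (SymplecticGroup.transpose_mem hSi) hSi
  obtain ⟨hY, hE⟩ := isSymm_blobY_and_blobMatrix_eq hG hGs
  have hX := posDef_blobX hG
  obtain ⟨c, hc⟩ := coherentState_eq_gaussianWave hħ hX (blobY ((S⁻¹)ᵀ * S⁻¹)) z₀ 0
  have hae : (gaussianWave hħ hX (blobY ((S⁻¹)ᵀ * S⁻¹)) z₀ c).toLp 2 volume =ᵐ[volume]
      coherentState ħ (blobX ((S⁻¹)ᵀ * S⁻¹)) (blobY ((S⁻¹)ᵀ * S⁻¹)) z₀ 0 :=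
    hc ▸ SchwartzMap.coeFn_toLp _ 2 volume
  refine ⟨_, ⟨_, _, z₀, 0, hX, hY, hae⟩, ?_⟩
  rw [correspondsTo_coherentState_iff hħ hX hY hae, hE]
  exact quantumBlob_eq_quadForm hħ.le z₀ (SymplecticGroup.symplectic_det hS)

theorem image_ellipsoid (R G : Matrix (Fin n ⊕ Fin n) (Fin n ⊕ Fin n) ℝ) (ħ t : ℝ)
    (z₀ : PhaseSpace n) :
    Matrix.toEuclideanLin (classicalFlow R t) '' {z | quadForm G (z - z₀) ≤ ħ} =
      {z | quadForm (transportedMatrix R G t)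
        (z - Matrix.toEuclideanLin (classicalFlow R t) z₀) ≤ ħ} := by
  ext w
  constructor
  · rintro ⟨u, hu, rfl⟩
    rw [Set.mem_ofPred_eq, ← map_sub, quadForm_transportedMatrix]
    exact hu
  · intro hw
    have h1 : Matrix.toEuclideanLin (classicalFlow R t)
        (Matrix.toEuclideanLin (classicalFlow R (-t)) w) = w := by
      rw [← toEuclideanLin_mul_apply, ← classicalFlow_add, add_neg_cancel, classicalFlow_zero,
        toEuclideanLin_one_apply]
    refine ⟨_, ?_, h1⟩
    rw [Set.mem_ofPred_eq, ← quadForm_transportedMatrix (R := R) t, map_sub, h1]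
    exact hw

end Correspondence

end QuantumBlobs

end

theorem mainTheorem4 (n : ℕ) (hn : 1 ≤ n) (ħ : ℝ) (hħ : 0 < ħ)
    (R : Matrix (Fin n ⊕ Fin n) (Fin n ⊕ Fin n) ℝ) (hR : R.IsSymm) :
    -- the matrices `S_t` are symplectic and are the flow of Hamilton's equations
    (∀ t : ℝ, QuantumBlobs.classicalFlow R t ∈ Matrix.symplecticGroup (Fin n) ℝ) ∧
    (∀ z : ℝ → QuantumBlobs.PhaseSpace n,
      QuantumBlobs.IsHamiltonTrajectory (QuantumBlobs.quadraticHamiltonian R) z ↔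
        ∀ t : ℝ, z t = Matrix.toEuclideanLin (QuantumBlobs.classicalFlow R t) (z 0)) ∧
    -- every squeezed coherent state has exactly one corresponding set, which is a quantum blob
    (∀ Ψ₀ : QuantumBlobs.StateSpace n, QuantumBlobs.IsSqueezedCoherentState ħ Ψ₀ →
      ∃ (z₀ : QuantumBlobs.PhaseSpace n) (S₀ : Matrix (Fin n ⊕ Fin n) (Fin n ⊕ Fin n) ℝ),
        S₀ ∈ Matrix.symplecticGroup (Fin n) ℝ ∧
        ∀ Q : Set (QuantumBlobs.PhaseSpace n),
          QuantumBlobs.CorrespondsTo ħ Ψ₀ Q ↔ Q = QuantumBlobs.quantumBlob ħ z₀ S₀) ∧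
    -- every quantum blob corresponds to some squeezed coherent state
    (∀ (z₀ : QuantumBlobs.PhaseSpace n) (S₀ : Matrix (Fin n ⊕ Fin n) (Fin n ⊕ Fin n) ℝ),
      S₀ ∈ Matrix.symplecticGroup (Fin n) ℝ →
      ∃ Ψ₀ : QuantumBlobs.StateSpace n, QuantumBlobs.IsSqueezedCoherentState ħ Ψ₀ ∧
        QuantumBlobs.CorrespondsTo ħ Ψ₀ (QuantumBlobs.quantumBlob ħ z₀ S₀)) ∧
    -- the quantum motion of the state induces the classical motion of the blob
    (∀ (z : ℝ → QuantumBlobs.PhaseSpace n) (S₀ : Matrix (Fin n ⊕ Fin n) (Fin n ⊕ Fin n) ℝ)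
      (Ψ₀ : QuantumBlobs.StateSpace n),
      QuantumBlobs.IsHamiltonTrajectory (QuantumBlobs.quadraticHamiltonian R) z →
      S₀ ∈ Matrix.symplecticGroup (Fin n) ℝ →
      QuantumBlobs.IsSqueezedCoherentState ħ Ψ₀ →
      QuantumBlobs.CorrespondsTo ħ Ψ₀ (QuantumBlobs.quantumBlob ħ (z 0) S₀) →
      ∃ Ψ : ℝ → QuantumBlobs.StateSpace n,
        QuantumBlobs.IsSchrodingerSolution ħ R Ψ ∧ Ψ 0 = Ψ₀ ∧
        (∀ Ψ' : ℝ → QuantumBlobs.StateSpace n,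
          QuantumBlobs.IsSchrodingerSolution ħ R Ψ' → Ψ' 0 = Ψ₀ → Ψ' = Ψ) ∧
        ∀ t : ℝ,
          QuantumBlobs.IsSqueezedCoherentState ħ (Ψ t) ∧
          (∀ Q : Set (QuantumBlobs.PhaseSpace n),
            QuantumBlobs.CorrespondsTo ħ (Ψ t) Q ↔
              Q = Matrix.toEuclideanLin (QuantumBlobs.classicalFlow R t) ''
                QuantumBlobs.quantumBlob ħ (z 0) S₀) ∧
          Matrix.toEuclideanLin (QuantumBlobs.classicalFlow R t) ''
              QuantumBlobs.quantumBlob ħ (z 0) S₀ =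
            QuantumBlobs.quantumBlob ħ (z t) (QuantumBlobs.classicalFlow R t * S₀)) := by
  refine ⟨QuantumBlobs.classicalFlow_mem_symplecticGroup R hR,
    QuantumBlobs.isHamiltonTrajectory_iff_flow R hR, ?_, ?_, ?_⟩
  · rintro Ψ₀ ⟨X, Y, z₀, γ, hX, hY, hΨ⟩
    obtain ⟨S, hS, hblob⟩ := QuantumBlobs.exists_quantumBlob_eq hħ hX hY z₀
    refine ⟨z₀, S, hS, fun Q => ?_⟩
    rw [hblob]
    exact QuantumBlobs.correspondsTo_coherentState_iff hħ hX hY hΨ Q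
  · exact fun z₀ S₀ hS₀ => QuantumBlobs.exists_state_of_symplectic hħ z₀ hS₀
  · rintro z S₀ Ψ₀ hz hS₀ ⟨X, Y, z₀, γ, hX, hY, hΨ⟩ hQ
    -- The centre `z₀` of the state is not identified with `z 0`, nor its matrix with that of `S₀`.
    -- The equality of the two ellipsoids as sets is enough, since the flow acts on sets.
    have hQ' := (QuantumBlobs.correspondsTo_coherentState_iff hħ hX hY hΨ _).1 hQ
    obtain ⟨c, hc⟩ := QuantumBlobs.coherentState_eq_gaussianWave hħ hX Y z₀ γ
    have hs := QuantumBlobs.isStrongSolution_gaussianFlow hħ hR hX hY z₀ c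
    have h0 : (QuantumBlobs.gaussianFlow hħ R hX hY z₀ c 0).toLp 2 volume = Ψ₀ := by
      rw [QuantumBlobs.gaussianFlow_zero]
      refine Lp.ext ((SchwartzMap.coeFn_toLp _ 2 volume).trans ?_)
      rw [← hc]
      exact hΨ.symm
    refine ⟨_, hs.isSchrodingerSolution, h0, fun Ψ' hΨ' h0' =>
      QuantumBlobs.IsSchrodingerSolution.unique hħ hR hΨ' hs.isSchrodingerSolution
        (h0'.trans h0.symm), fun t => ?_⟩
    obtain ⟨γ', hγ'⟩ := QuantumBlobs.exists_gaussianFlow_eq_coherentState hħ hR hX hY z₀ γ hc t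
    have hG := QuantumBlobs.posDef_transportedMatrix (R := R)
      (QuantumBlobs.posDef_blobMatrix hX hY) t
    obtain ⟨hYt, hE⟩ := QuantumBlobs.isSymm_blobY_and_blobMatrix_eq hG
      (QuantumBlobs.transportedMatrix_mem_symplecticGroup hR
        (QuantumBlobs.blobMatrix_mem_symplecticGroup hX hY) t)
    have hae := hγ' ▸ SchwartzMap.coeFn_toLp (QuantumBlobs.gaussianFlow hħ R hX hY z₀ c t) 2 volume
    refine ⟨⟨_, _, _, γ', QuantumBlobs.posDef_blobX hG, hYt, hae⟩, fun Q => ?_, ?_⟩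
    · rw [QuantumBlobs.correspondsTo_coherentState_iff hħ (QuantumBlobs.posDef_blobX hG) hYt hae,
        hE, hQ', QuantumBlobs.image_ellipsoid]
    · rw [QuantumBlobs.image_quantumBlob,
        ← (QuantumBlobs.isHamiltonTrajectory_iff_flow R hR z).1 hz t]
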